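/- Let $\Omega\subset\mathbb{R}\times(\mathbb{R}^3\setminus\{0\})$ be open, connected and invariant under the rotations $(t,x)\mapsto(t,Ax)$, $A\in SO(3)$, and let $g$ be a smooth Lorentzian metric on $\Omega$ (signature $(-,+,+,+)$) for which all these rotations are isometries, i.e. a spherically symmetric four-dimensional spacetime. Suppose that $g$ is Einstein: $R_{\mu\nu}=\Lambda g_{\mu\nu}$ with a constant $\Lambda\in\mathbb{R}$. Put $\lambda=\Lambda/6$, and let $R>0$ be the areal radius: the rotation orbit through a point $p$ is a round sphere of radius $R(p)$. Let $d\Omega^2$ be the round metric of the unit sphere $\mathbb{S}^2$ pulled back by $(t,x)\mapsto x/|x|$. Then $g$ is Schwarzschild–(A)de Sitter: there is a constant $M\in\mathbb{R}$ such that the following hold. (i) Every point $p\in\Omega$ at which $g(\nabla R,\nabla R)\neq0$ has a rotation-invariant open neighbourhood in $\Omega$ with a smooth rotation-invariant function $T$ such that $T$, $R$ and the direction $x/|x|\in\mathbb{S}^2$ are coordinates on it, in which $$ds^2=-\Big(1-\frac{2M}{R}-2\lambda R^2\Big)dT^2+\Big(1-\frac{2M}{R}-2\lambda R^2\Big)^{-1}dR^2+R^2\,d\Omega^2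 ,$$ where $1-2M/R-2\lambda R^2\neq0$. (ii) If $\Omega=\{(t,x): t\in I,\ |x|\in J\}$ with open intervals $I\subset\mathbb{R}$, $J\subset(0,\infty)$, and with $r=|x|$ the metric has the form $$ds^2=-e^{2v(t,r)}dt^2+e^{2f(t,r)}dr^2+r^2\,d\Omega^2$$ on $\Omega$, then $1-2M/r-2\lambda r^2>0$ on $J$, and after a smooth change of the time coordinate $T=\tau(t)$ with $\tau'>0$ one has on all of $\Omega$ $$ds^2=-\Big(1-\frac{2M}{r}-2\lambda r^2\Big)dT^2+\Big(1-\frac{2M}{r}-2\lambda r^2\Big)^{-1}dr^2+r^2\,d\Omega^2 .$$ -/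

import Mathlib

open scoped ContDiff Matrix

noncomputable section

/-- Coordinate space `ℝ × ℝ³`: the coordinate `x 0` is a time label, `(x 1, x 2, x 3)` are Cartesian
spatial coordinates. -/
abbrev Coord : Type := Fin 4 → ℝ

/-- A field of `4 × 4` matrices: the components `g x i j` of a symmetric 2-tensor field. -/
abbrev MetricField : Type := Coord → Matrix (Fin 4) (Fin 4) ℝ

/-- The `i`-th partial derivative. -/
def pd (i : Fin 4) (u : Coord → ℝ) (x : Coord) : ℝ := fderiv ℝ u x (Pi.single i 1)

/-- Christoffel symbols `Γ^k_{ij}` of the Levi-Civita connection. -/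
def christoffel (g : MetricField) (k i j : Fin 4) (x : Coord) : ℝ :=
  (1 / 2) * ∑ l, (g x)⁻¹ k l *
    (pd i (fun y => g y l j) x + pd j (fun y => g y l i) x - pd l (fun y => g y i j) x)

/-- Ricci tensor `R_{ij} = ∂_k Γ^k_{ij} - ∂_j Γ^k_{ik} + Γ^k_{kl} Γ^l_{ij} - Γ^k_{jl} Γ^l_{ik}`. -/
def ricci (g : MetricField) (i j : Fin 4) (x : Coord) : ℝ :=
  ∑ k, (pd k (christoffel g k i j) x - pd j (christoffel g k i k) x
    + ∑ l, (christoffel g k k l x * christoffel g l i j x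
      - christoffel g k j l x * christoffel g l i k x))

/-- The Einstein condition `R_{ij} = Λ g_{ij}` on `Ω`, with a constant `Λ`. -/
def IsEinstein (Ω : Set Coord) (g : MetricField) (Λ : ℝ) : Prop :=
  ∀ x ∈ Ω, ∀ i j, ricci g i j x = Λ * g x i j

/-- A symmetric matrix of signature `(-, +, +, +)`. -/
def IsLorentzian (G : Matrix (Fin 4) (Fin 4) ℝ) : Prop :=
  G.IsSymm ∧ ∃ P : Matrix (Fin 4) (Fin 4) ℝ,
    IsUnit P.det ∧ Pᵀ * G * P = Matrix.diagonal ![-1, 1, 1, 1]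

/-- The matrix of the map `(t, x) ↦ (t, A x)`. -/
def rotMatrix (A : Matrix (Fin 3) (Fin 3) ℝ) : Matrix (Fin 4) (Fin 4) ℝ :=
  !![1, 0, 0, 0;
     0, A 0 0, A 0 1, A 0 2;
     0, A 1 0, A 1 1, A 1 2;
     0, A 2 0, A 2 1, A 2 2]

/-- A set of coordinate points that is mapped into itself by every rotation in `SO(3)`. -/
def IsRotInvariantSet (V : Set Coord) : Prop :=
  ∀ A ∈ Matrix.specialOrthogonalGroup (Fin 3) ℝ, ∀ x ∈ V, rotMatrix A *ᵥ x ∈ V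

/-- A function that is constant on the rotation orbits in `V`. -/
def IsRotInvariantFun (V : Set Coord) (u : Coord → ℝ) : Prop :=
  ∀ A ∈ Matrix.specialOrthogonalGroup (Fin 3) ℝ, ∀ x ∈ V, u (rotMatrix A *ᵥ x) = u x

/-- The Euclidean length `|x|` of the spatial coordinates. -/
def radius (x : Coord) : ℝ := √(x 1 ^ 2 + x 2 ^ 2 + x 3 ^ 2)

/-- A spherically symmetric spacetime: a smooth Lorentzian metric on a connected open subset of
`ℝ × (ℝ³ ∖ {0})`, on which every rotation in `SO(3)` acts as an isometry. -/
structure IsSphericallySymmetricSpacetime (Ω : Set Coord) (g : MetricField) : Prop where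
  isOpen : IsOpen Ω
  isConnected : IsConnected Ω
  radius_pos : ∀ x ∈ Ω, 0 < radius x
  rot_mem : IsRotInvariantSet Ω
  smooth : ∀ i j, ContDiffOn ℝ ∞ (fun x => g x i j) Ω
  lorentzian : ∀ x ∈ Ω, IsLorentzian (g x)
  isometry : ∀ A ∈ Matrix.specialOrthogonalGroup (Fin 3) ℝ, ∀ x ∈ Ω,
    (rotMatrix A)ᵀ * g (rotMatrix A *ᵥ x) * rotMatrix A = g x

/-- The three infinitesimal generators of the rotations, `ξ_k (t, x) = (0, e_k × x)`. -/
def rotField (k : Fin 3) (x : Coord) : Fin 4 → ℝ :=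
  (![![0, 0, -x 3, x 2], ![0, x 3, 0, -x 1], ![0, -x 2, x 1, 0]] : Fin 3 → Fin 4 → ℝ) k

/-- The areal radius `R`: the rotation orbit through `x` is a round sphere of radius `R`. On a round
sphere of radius `R` one has `∑ k, g(ξ_k, ξ_k) = 2 R²`. -/
def arealRadius (g : MetricField) (x : Coord) : ℝ :=
  √((1 / 2) * ∑ k, rotField k x ⬝ᵥ (g x *ᵥ rotField k x))

/-- `g(∇u, ∇u) = g^{ij} ∂_i u ∂_j u`. -/
def gradSq (g : MetricField) (u : Coord → ℝ) (x : Coord) : ℝ :=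
  ∑ i, ∑ j, (g x)⁻¹ i j * pd i u x * pd j u x

/-- Components of `dΩ²`, the round metric of the unit sphere pulled back by `(t, x) ↦ x / |x|`. -/
def roundMetric (x : Coord) (i j : Fin 4) : ℝ :=
  if i = 0 ∨ j = 0 then 0
  else ((if i = j then 1 else 0) - x i * x j / radius x ^ 2) / radius x ^ 2

/-- `1 - 2M/r - 2λr²`. -/
def sdsF (M lam r : ℝ) : ℝ := 1 - 2 * M / r - 2 * lam * r ^ 2

/-- On the rotation invariant open set `V`, the functions `T`, `R` and the direction `x / |x|` are
coordinates in which the metric is the Schwarzschild-(A)de Sitter metric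
`-(1 - 2M/R - 2λR²) dT² + (1 - 2M/R - 2λR²)⁻¹ dR² + R² dΩ²`.
(The coordinate map is a local diffeomorphism because `g` is nondegenerate.) -/
structure IsSdSChart (M lam : ℝ) (g : MetricField) (V : Set Coord) (T R : Coord → ℝ) : Prop where
  isOpen : IsOpen V
  rot_mem : IsRotInvariantSet V
  smooth_time : ContDiffOn ℝ ∞ T V
  smooth_radius : ContDiffOn ℝ ∞ R V
  rot_time : IsRotInvariantFun V T
  rot_radius : IsRotInvariantFun V R
  injOn : Set.InjOn (fun x => (T x, R x, fun k : Fin 3 => x k.succ / radius x)) V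
  radius_pos : ∀ x ∈ V, 0 < R x
  sdsF_ne_zero : ∀ x ∈ V, sdsF M lam (R x) ≠ 0
  metric_eq : ∀ x ∈ V, ∀ i j, g x i j =
    -sdsF M lam (R x) * pd i T x * pd j T x
      + (sdsF M lam (R x))⁻¹ * pd i R x * pd j R x
      + R x ^ 2 * roundMetric x i j

/-- On `{(t, x) | t ∈ I, |x| ∈ J}`, with open intervals `I` and `J ⊆ (0, ∞)`, the metric is
`-e^{2v(t,r)} dt² + e^{2f(t,r)} dr² + r² dΩ²`, where `r = |x|`. -/
structure HasStandardForm (Ω : Set Coord) (g : MetricField) (I J : Set ℝ) (v f : ℝ → ℝ → ℝ) :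
    Prop where
  isOpen_time : IsOpen I
  interval_time : I.OrdConnected
  isOpen_radius : IsOpen J
  interval_radius : J.OrdConnected
  radius_pos : J ⊆ Set.Ioi 0
  domain_eq : Ω = {x | x 0 ∈ I ∧ radius x ∈ J}
  metric_eq : ∀ x ∈ Ω, ∀ i j, g x i j =
    -Real.exp (2 * v (x 0) (radius x)) * pd i (fun y => y 0) x * pd j (fun y => y 0) x
      + Real.exp (2 * f (x 0) (radius x)) * pd i radius x * pd j radius x
      + radius x ^ 2 * roundMetric x i j

end

/-! A spherically symmetric metric is a warped product. The half plane of rotation orbits, with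
coordinates t and r = |x|, carries a Lorentzian metric h = A dt² + 2B dt dr + C dr² and a function R
> 0, and g = h + R² dΩ². All of these can be read off on the first coordinate axis. In two
dimensions the Ricci tensor of h is a multiple of h, so the (t,r)-block of the Einstein equation
makes the Hessian of R a multiple of h. The angular equation fixes the factor: 2R∇∇R = (1 - |∇R|² -
ΛR²) h (`isReducedEinstein`).

The rest follows from this equation. Put N = |∇R|². Contraction with ∇R gives R dN = (1 - N - ΛR²)
dR, so R(1 - N) - ΛR³/3 has zero differential and equals a constant 2M on the connected orbit space
(`exists_mass`); this is N = 1 - 2M/R - 2λR². The trace gives R□R = 1 - N - ΛR², and together with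
the formula for dN this makes ⋆dR/N closed where N ≠ 0 (`timeForm_closed`). Any primitive T
satisfies h = -N dT² + N⁻¹ dR² (`metric_eq`), which gives the local charts. For a metric in standard
form, R = r, N > 0 and ⋆dR/N has no dr-component; the orbit space is a rectangle, so T exists
globally and depends on t alone.

The reduction must start from the Ricci tensor in Cartesian coordinates. The Killing equations and
their first derivatives express the full 2-jet of g at an axis point through A, B, C, a = R²/r² and
their t- and r-derivatives (`axialData`). Since the Ricci tensor is algebraic in the inverse metric
and this jet (`ricci_eq_ricciExpr`), its components on the axis become explicit polynomials. -/

noncomputable section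

/-! ### Partial derivatives and the Ricci tensor as a function of the 2-jet -/

/-- The matrix of partial derivatives of the components of a matrix field. -/
def pdMat (k : Fin 4) (g : MetricField) : MetricField :=
  fun x i j => pd k (fun y => g y i j) x

/-- The Ricci tensor as an algebraic expression in the inverse metric `G`, the first derivatives
`D k` and the second derivatives `H m k` of the metric. -/
def ricciExpr (G : Matrix (Fin 4) (Fin 4) ℝ) (D : Fin 4 → Matrix (Fin 4) (Fin 4) ℝ)
    (H : Fin 4 → Fin 4 → Matrix (Fin 4) (Fin 4) ℝ) (i j : Fin 4) : ℝ :=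
  let Γ : Fin 4 → Fin 4 → Fin 4 → ℝ := fun k i j =>
    (1 / 2) * ∑ l, G k l * (D i l j + D j l i - D l i j)
  let dΓ : Fin 4 → Fin 4 → Fin 4 → Fin 4 → ℝ := fun m k i j =>
    (1 / 2) * ∑ l, (-(∑ b, (∑ a, G k a * D m a b) * G b l) * (D i l j + D j l i - D l i j)
      + G k l * (H m i l j + H m j l i - H m l i j))
  ∑ k, (dΓ k k i j - dΓ j k i k + ∑ l, (Γ k k l * Γ l i j - Γ k j l * Γ l i k))

theorem pd_add {i : Fin 4} {u v : Coord → ℝ} {x : Coord} (hu : DifferentiableAt ℝ u x)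
    (hv : DifferentiableAt ℝ v x) : pd i (fun y => u y + v y) x = pd i u x + pd i v x := by
  simp only [pd]; rw [fderiv_fun_add hu hv]; rfl

theorem pd_sub {i : Fin 4} {u v : Coord → ℝ} {x : Coord} (hu : DifferentiableAt ℝ u x)
    (hv : DifferentiableAt ℝ v x) : pd i (fun y => u y - v y) x = pd i u x - pd i v x := by
  simp only [pd]; rw [fderiv_fun_sub hu hv]; rfl

theorem pd_mul {i : Fin 4} {u v : Coord → ℝ} {x : Coord} (hu : DifferentiableAt ℝ u x)
    (hv : DifferentiableAt ℝ v x) :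
    pd i (fun y => u y * v y) x = pd i u x * v x + u x * pd i v x := by
  simp only [pd]; rw [fderiv_fun_mul hu hv]; simp; ring

theorem pd_const_mul {i : Fin 4} {c : ℝ} {v : Coord → ℝ} {x : Coord}
    (hv : DifferentiableAt ℝ v x) :
    pd i (fun y => c * v y) x = c * pd i v x := by
  simp only [pd]; rw [fderiv_const_mul hv]; simp

theorem pd_sum {ι : Type*} {s : Finset ι} {i : Fin 4} {u : ι → Coord → ℝ} {x : Coord}
    (hu : ∀ l ∈ s, DifferentiableAt ℝ (u l) x) :
    pd i (fun y => ∑ l ∈ s, u l y) x = ∑ l ∈ s, pd i (u l) x := by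
  simp only [pd]; rw [fderiv_fun_sum hu]; simp

theorem pd_congr {i : Fin 4} {u v : Coord → ℝ} {x : Coord} (h : u =ᶠ[nhds x] v) :
    pd i u x = pd i v x := by
  simp only [pd]; rw [h.fderiv_eq]

theorem pd_const {i : Fin 4} {c : ℝ} {x : Coord} : pd i (fun _ => c) x = 0 := by
  simp [pd]

theorem pd_coord {i j : Fin 4} {x : Coord} : pd i (fun y => y j) x = if i = j then 1 else 0 := by
  have : HasFDerivAt (fun y : Coord => y j) (ContinuousLinearMap.proj (R := ℝ) (φ := fun _ => ℝ) j) x :=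
    hasFDerivAt_apply j x
  simp only [pd, this.fderiv]
  simp [Pi.single_apply, eq_comm]

theorem ContDiffOn.pd {Ω : Set Coord} (hΩ : IsOpen Ω) {u : Coord → ℝ} (hu : ContDiffOn ℝ ∞ u Ω)
    (i : Fin 4) : ContDiffOn ℝ ∞ (pd i u) Ω := by
  have h := (contDiffOn_infty_iff_fderiv_of_isOpen hΩ).1 hu
  exact h.2.clm_apply contDiffOn_const

theorem pd_comm {Ω : Set Coord} (hΩ : IsOpen Ω) {u : Coord → ℝ} (hu : ContDiffOn ℝ ∞ u Ω)
    {x : Coord} (hx : x ∈ Ω) (i j : Fin 4) : pd i (pd j u) x = pd j (pd i u) x := by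
  have h := (contDiffOn_infty_iff_fderiv_of_isOpen hΩ).1 hu
  have hd : DifferentiableAt ℝ (fderiv ℝ u) x :=
    (h.2.contDiffAt (hΩ.mem_nhds hx)).differentiableAt (by simp)
  have hs : IsSymmSndFDerivAt ℝ u x :=
    (hu.contDiffAt (hΩ.mem_nhds hx)).isSymmSndFDerivAt (by
      simp only [minSmoothness_of_isRCLikeNormedField]
      exact WithTop.coe_le_coe.2 le_top)
  have key : ∀ a b : Coord, fderiv ℝ (fun y => fderiv ℝ u y a) x b = fderiv ℝ (fderiv ℝ u) x b a := by
    intro a b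
    rw [fderiv_clm_apply hd (differentiableAt_const a)]
    simp
  change fderiv ℝ (fun y => fderiv ℝ u y _) x _ = fderiv ℝ (fun y => fderiv ℝ u y _) x _
  rw [key, key]
  exact hs _ _

theorem ContDiffOn.matrix_det {n : ℕ} {Ω : Set Coord} {g : Coord → Matrix (Fin n) (Fin n) ℝ}
    (hg : ∀ i j, ContDiffOn ℝ ∞ (fun x => g x i j) Ω) :
    ContDiffOn ℝ ∞ (fun x => (g x).det) Ω := by
  simp only [Matrix.det_apply']
  refine ContDiffOn.sum fun σ _ => contDiffOn_const.mul ?_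
  exact contDiffOn_prod fun i _ => hg _ _

theorem ContDiffOn.matrix_inv {Ω : Set Coord} {g : MetricField}
    (hg : ∀ i j, ContDiffOn ℝ ∞ (fun x => g x i j) Ω) (hdet : ∀ x ∈ Ω, (g x).det ≠ 0)
    (k l : Fin 4) : ContDiffOn ℝ ∞ (fun x => (g x)⁻¹ k l) Ω := by
  have hadj : ContDiffOn ℝ ∞ (fun x => (g x).adjugate k l) Ω := by
    simp only [Matrix.adjugate_apply]
    refine ContDiffOn.matrix_det fun i j => ?_
    simp only [Matrix.updateRow_apply]
    split_ifs
    · exact contDiffOn_const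
    · exact hg _ _
  have := ((ContDiffOn.matrix_det hg).inv hdet).mul hadj
  refine this.congr fun x _ => ?_
  simp [Matrix.inv_def]

/-- Differentiate `(g y)⁻¹ * g y = 1`, which holds near `x`, and solve for the derivative of the
inverse. -/
theorem pdMat_inv {Ω : Set Coord} (hΩ : IsOpen Ω) {g : MetricField}
    (hg : ∀ i j, ContDiffOn ℝ ∞ (fun x => g x i j) Ω) (hdet : ∀ x ∈ Ω, (g x).det ≠ 0)
    {x : Coord} (hx : x ∈ Ω) (m : Fin 4) :
    pdMat m (fun y => (g y)⁻¹) x = -((g x)⁻¹ * pdMat m g x * (g x)⁻¹) := by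
  have dg : ∀ i j, DifferentiableAt ℝ (fun x => g x i j) x := fun i j =>
    ((hg i j).contDiffAt (hΩ.mem_nhds hx)).differentiableAt (by simp)
  have dG : ∀ i j, DifferentiableAt ℝ (fun x => (g x)⁻¹ i j) x := fun i j =>
    ((ContDiffOn.matrix_inv hg hdet i j).contDiffAt (hΩ.mem_nhds hx)).differentiableAt (by simp)
  have h1 : pdMat m (fun y => (g y)⁻¹) x * g x + (g x)⁻¹ * pdMat m g x = 0 := by
    ext i j
    have e1 : (fun y => ∑ l, (g y)⁻¹ i l * g y l j) =ᶠ[nhds x]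
        fun _ => (1 : Matrix (Fin 4) (Fin 4) ℝ) i j := by
      filter_upwards [hΩ.mem_nhds hx] with y hy
      rw [← Matrix.mul_apply, Matrix.nonsing_inv_mul _ (hdet y hy).isUnit]
    have e2 := pd_congr (i := m) e1
    rw [pd_const, pd_sum fun l _ => (dG i l).fun_mul (dg l j)] at e2
    simp only [pd_mul (dG i _) (dg _ j)] at e2
    rw [Finset.sum_add_distrib] at e2
    simpa [Matrix.mul_apply, pdMat] using e2
  have hu := (hdet x hx).isUnit
  calc pdMat m (fun y => (g y)⁻¹) x
      = pdMat m (fun y => (g y)⁻¹) x * g x * (g x)⁻¹ := by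
        rw [Matrix.mul_assoc, Matrix.mul_nonsing_inv _ hu, Matrix.mul_one]
    _ = _ := by rw [eq_neg_of_add_eq_zero_left h1, Matrix.neg_mul]

/-- With the derivative of the inverse eliminated, the Ricci tensor at a point sees only the inverse
metric and the first two derivatives there, so it can be evaluated once these matrices are known. -/
theorem ricci_eq_ricciExpr {Ω : Set Coord} (hΩ : IsOpen Ω) {g : MetricField}
    (hg : ∀ i j, ContDiffOn ℝ ∞ (fun x => g x i j) Ω) (hdet : ∀ x ∈ Ω, (g x).det ≠ 0)
    {x : Coord} (hx : x ∈ Ω) (i j : Fin 4) :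
    ricci g i j x =
      ricciExpr (g x)⁻¹ (fun k => pdMat k g x) (fun m k => pdMat m (pdMat k g) x) i j := by
  have dG : ∀ i j, DifferentiableAt ℝ (fun x => (g x)⁻¹ i j) x := fun i j =>
    ((ContDiffOn.matrix_inv hg hdet i j).contDiffAt (hΩ.mem_nhds hx)).differentiableAt (by simp)
  have dD : ∀ k i j, DifferentiableAt ℝ (pd k (fun x => g x i j)) x := fun k i j =>
    (((hg i j).pd hΩ k).contDiffAt (hΩ.mem_nhds hx)).differentiableAt (by simp)
  have hΓ : ∀ m k i j, pd m (christoffel g k i j) x = (1 / 2) * ∑ l,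
      (-(∑ b, (∑ a, (g x)⁻¹ k a * pdMat m g x a b) * (g x)⁻¹ b l) *
        (pdMat i g x l j + pdMat j g x l i - pdMat l g x i j)
      + (g x)⁻¹ k l * (pdMat m (pdMat i g) x l j + pdMat m (pdMat j g) x l i
        - pdMat m (pdMat l g) x i j)) := by
    intro m k i j
    have e : ∀ l, pd m (fun y => (g y)⁻¹ k l) x =
        -(∑ b, (∑ a, (g x)⁻¹ k a * pdMat m g x a b) * (g x)⁻¹ b l) := fun l => by
      have := congrFun (congrFun (pdMat_inv hΩ hg hdet hx m) k) l
      simpa only [pdMat, Matrix.neg_apply, Matrix.mul_apply] using this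
    unfold christoffel
    rw [pd_const_mul, pd_sum]
    · congr 1
      refine Finset.sum_congr rfl fun l _ => ?_
      rw [pd_mul (dG k l), pd_sub, pd_add, e]
      · rfl
      all_goals fun_prop (disch := assumption)
    · exact fun l _ => (dG k l).mul (((dD _ _ _).add (dD _ _ _)).sub (dD _ _ _))
    · exact DifferentiableAt.fun_sum
        fun l _ => (dG k l).mul (((dD _ _ _).add (dD _ _ _)).sub (dD _ _ _))
  unfold ricci ricciExpr
  simp only [hΓ]
  rfl

/-! ### Rotations and the Killing equation -/

theorem fderiv_eq_sum_pd (u : Coord → ℝ) (x v : Coord) :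
    fderiv ℝ u x v = ∑ k, v k * pd k u x := by
  conv_lhs => rw [pi_eq_sum_univ' v]
  simp [pd, map_sum]

theorem rotMatrix_one : rotMatrix 1 = 1 := by
  ext i j; fin_cases i <;> fin_cases j <;> simp [rotMatrix]

theorem rotMatrix_mul (A B : Matrix (Fin 3) (Fin 3) ℝ) :
    rotMatrix (A * B) = rotMatrix A * rotMatrix B := by
  ext i j; fin_cases i <;> fin_cases j <;>
    simp [rotMatrix, Matrix.mul_apply, Fin.sum_univ_succ]

theorem rotMatrix_transpose (A : Matrix (Fin 3) (Fin 3) ℝ) :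
    rotMatrix Aᵀ = (rotMatrix A)ᵀ := by
  ext i j; fin_cases i <;> fin_cases j <;> simp [rotMatrix]

/-- The metric satisfies the Killing equation of a generator of the rotations. -/
theorem IsSphericallySymmetricSpacetime.killing {Ω : Set Coord} {g : MetricField}
    (hg : IsSphericallySymmetricSpacetime Ω g) {A : ℝ → Matrix (Fin 3) (Fin 3) ℝ}
    (hA : ∀ θ, A θ ∈ Matrix.specialOrthogonalGroup (Fin 3) ℝ) (hA0 : A 0 = 1)
    {X : Matrix (Fin 4) (Fin 4) ℝ}
    (hX : ∀ i j, HasDerivAt (fun θ => rotMatrix (A θ) i j) (X i j) 0) (hskew : Xᵀ = -X)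
    {x : Coord} (hx : x ∈ Ω) :
    ∑ k, (X *ᵥ x) k • pdMat k g x = X * g x - g x * X := by
  ext i j
  have hρ0 : ∀ i j, rotMatrix (A 0) i j = (1 : Matrix (Fin 4) (Fin 4) ℝ) i j := by
    rw [hA0, rotMatrix_one]; exact fun _ _ => rfl
  have hx0 : rotMatrix (A 0) *ᵥ x = x := by rw [hA0, rotMatrix_one, Matrix.one_mulVec]
  have hmv : HasDerivAt (fun θ => rotMatrix (A θ) *ᵥ x) (X *ᵥ x) 0 := by
    rw [hasDerivAt_pi]
    intro i
    simp only [Matrix.mulVec, dotProduct]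
    exact HasDerivAt.fun_sum fun j _ => (hX i j).mul_const _
  have hgd : ∀ a b, HasDerivAt (fun θ => g (rotMatrix (A θ) *ᵥ x) a b)
      (∑ k, (X *ᵥ x) k * pdMat k g x a b) 0 := by
    intro a b
    have h1 : DifferentiableAt ℝ (fun y => g y a b) (rotMatrix (A 0) *ᵥ x) := by
      rw [hx0]
      exact ((hg.smooth a b).contDiffAt (hg.isOpen.mem_nhds hx)).differentiableAt (by simp)
    have h2 := h1.hasFDerivAt.comp_hasDerivAt (0 : ℝ) hmv
    rw [fderiv_eq_sum_pd, hx0] at h2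
    exact h2
  have hsum := HasDerivAt.fun_sum (u := Finset.univ) fun b (_ : b ∈ Finset.univ) =>
    (HasDerivAt.fun_sum (u := Finset.univ) fun a (_ : a ∈ Finset.univ) =>
      (hX a i).fun_mul (hgd a b)).fun_mul (hX b j)
  have hconst : (fun θ => ∑ b, (∑ a, rotMatrix (A θ) a i * g (rotMatrix (A θ) *ᵥ x) a b)
      * rotMatrix (A θ) b j) = fun _ => g x i j := by
    funext θ
    have := congrFun (congrFun (hg.isometry (A θ) (hA θ) x hx) i) j
    simpa only [Matrix.mul_apply, Matrix.transpose_apply] using this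
  -- By invariance the differentiated function is constant in θ, so Xᵀg + gX plus the derivative of
  -- g along Xx vanishes; skewness replaces Xᵀ by -X.
  rw [hconst] at hsum
  have h0 := hsum.unique (hasDerivAt_const (0 : ℝ) (g x i j))
  simp only [hx0, hρ0, Matrix.one_apply, ite_mul, mul_ite, one_mul, zero_mul, mul_one, mul_zero,
    Finset.sum_add_distrib, Finset.sum_ite_eq', Finset.mem_univ, if_true] at h0
  have hsk : ∀ a b, X a b = -X b a := fun a b => by
    have := congrFun (congrFun hskew b) a
    simpa using this
  simp only [Matrix.sub_apply, Matrix.mul_apply, Matrix.sum_apply, Matrix.smul_apply, smul_eq_mul]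
  have h3 : ∑ a, X a i * g x a j = -∑ a, X i a * g x a j := by
    rw [← Finset.sum_neg_distrib]
    exact Finset.sum_congr rfl fun a _ => by rw [hsk]; ring
  linarith

/-- The generators of the rotations in the planes `12`, `13` and `23`. -/
def rotGen : Fin 3 → Matrix (Fin 4) (Fin 4) ℝ :=
  ![!![0, 0, 0, 0; 0, 0, -1, 0; 0, 1, 0, 0; 0, 0, 0, 0],
    !![0, 0, 0, 0; 0, 0, 0, -1; 0, 0, 0, 0; 0, 1, 0, 0],
    !![0, 0, 0, 0; 0, 0, 0, 0; 0, 0, 0, -1; 0, 0, 1, 0]]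

/-- The rotations in the planes `12`, `13` and `23`. -/
def planeRot (m : Fin 3) (c s : ℝ) : Matrix (Fin 3) (Fin 3) ℝ :=
  (![!![c, -s, 0; s, c, 0; 0, 0, 1], !![c, 0, -s; 0, 1, 0; s, 0, c],
    !![1, 0, 0; 0, c, -s; 0, s, c]] : Fin 3 → Matrix (Fin 3) (Fin 3) ℝ) m

theorem planeRot_mem (m : Fin 3) {c s : ℝ} (h : c ^ 2 + s ^ 2 = 1) :
    planeRot m c s ∈ Matrix.specialOrthogonalGroup (Fin 3) ℝ := by
  rw [Matrix.mem_specialOrthogonalGroup_iff, Matrix.mem_orthogonalGroup_iff, Matrix.det_fin_three]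
  fin_cases m <;> refine ⟨?_, ?_⟩
  all_goals first
    | (ext i j; fin_cases i <;> fin_cases j <;>
        simp [planeRot, Matrix.mul_apply, Fin.sum_univ_succ] <;> linarith)
    | (simp [planeRot]; linarith)

theorem IsSphericallySymmetricSpacetime.killing_rotGen {Ω : Set Coord} {g : MetricField}
    (hg : IsSphericallySymmetricSpacetime Ω g) (m : Fin 3) {x : Coord} (hx : x ∈ Ω) :
    ∑ k, (rotGen m *ᵥ x) k • pdMat k g x = rotGen m * g x - g x * rotGen m := by
  refine hg.killing (A := fun θ => planeRot m (Real.cos θ) (Real.sin θ))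
    (fun θ => planeRot_mem m (Real.cos_sq_add_sin_sq θ)) ?_ ?_ ?_ hx
  · ext i j; fin_cases m <;> fin_cases i <;> fin_cases j <;> simp [planeRot]
  · have hc : HasDerivAt Real.cos 0 0 := by simpa using Real.hasDerivAt_cos 0
    have hs : HasDerivAt Real.sin 1 0 := by simpa using Real.hasDerivAt_sin 0
    have hs' : HasDerivAt (fun θ => -Real.sin θ) (-1) 0 := hs.neg
    intro i j
    fin_cases m <;> fin_cases i <;> fin_cases j <;> simp [planeRot, rotMatrix, rotGen] <;>
      first | exact hasDerivAt_const _ _ | assumption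
  · ext i j; fin_cases m <;> fin_cases i <;> fin_cases j <;> simp [rotGen]

/-- The first derivative of the Killing equation. -/
theorem IsSphericallySymmetricSpacetime.pd_killing_rotGen {Ω : Set Coord} {g : MetricField}
    (hg : IsSphericallySymmetricSpacetime Ω g) (m : Fin 3) {x : Coord} (hx : x ∈ Ω) (n : Fin 4) :
    ∑ k, (rotGen m k n • pdMat k g x + (rotGen m *ᵥ x) k • pdMat n (pdMat k g) x) =
      rotGen m * pdMat n g x - pdMat n g x * rotGen m := by
  ext i j
  have dg : ∀ i j, DifferentiableAt ℝ (fun x => g x i j) x := fun i j =>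
    ((hg.smooth i j).contDiffAt (hg.isOpen.mem_nhds hx)).differentiableAt (by simp)
  have dD : ∀ k, DifferentiableAt ℝ (fun y => pdMat k g y i j) x := fun k =>
    (((hg.smooth i j).pd hg.isOpen k).contDiffAt (hg.isOpen.mem_nhds hx)).differentiableAt (by simp)
  have dX : ∀ k, DifferentiableAt ℝ (fun y => (rotGen m *ᵥ y) k) x := fun k => by
    simp only [Matrix.mulVec, dotProduct]; fun_prop
  have pX : ∀ k, pd n (fun y => (rotGen m *ᵥ y) k) x = rotGen m k n := fun k => by
    simp only [Matrix.mulVec, dotProduct]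
    have hc : ∀ l c, pd n (fun y : Coord => c * y l) x = c * if n = l then 1 else 0 := fun l c => by
      rw [pd_const_mul (by fun_prop), pd_coord]
    rw [pd_sum fun l _ => by fun_prop]
    simp only [hc]
    simp
  have e1 : (fun y => ∑ k, (rotGen m *ᵥ y) k * pdMat k g y i j) =ᶠ[nhds x]
      fun y => ∑ l, rotGen m i l * g y l j - ∑ l, rotGen m l j * g y i l := by
    filter_upwards [hg.isOpen.mem_nhds hx] with y hy
    have := congrFun (congrFun (hg.killing_rotGen m hy) i) j
    simp only [Matrix.sub_apply, Matrix.mul_apply, Matrix.sum_apply, Matrix.smul_apply,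
      smul_eq_mul] at this
    rw [this]
    congr 1
    exact Finset.sum_congr rfl fun _ _ => mul_comm _ _
  have e2 := pd_congr (i := n) e1
  rw [pd_sum fun k _ => (dX k).fun_mul (dD k), pd_sub, pd_sum, pd_sum] at e2
  · simp only [pd_mul (dX _) (dD _), pd_const_mul (dg _ _), pX] at e2
    simp only [Matrix.sub_apply, Matrix.mul_apply, Matrix.sum_apply, Matrix.smul_apply,
      Matrix.add_apply, smul_eq_mul]
    refine e2.trans ?_
    congr 1
    exact Finset.sum_congr rfl fun _ _ => mul_comm _ _
  · exact fun l _ => (dg _ _).const_mul _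
  · exact fun l _ => (dg _ _).const_mul _
  · exact DifferentiableAt.fun_sum fun l _ => (dg _ _).const_mul _
  · exact DifferentiableAt.fun_sum fun l _ => (dg _ _).const_mul _

/-! ### The 2-jet of the metric on the first axis -/

/-- The point of the first spatial axis with time coordinate `z.1` at position `z.2`. -/
def axisPt (z : ℝ × ℝ) : Coord := ![z.1, z.2, 0, 0]

/-- The components of a symmetric tensor invariant under rotations about the first axis. -/
def axialMat (A B C a : ℝ) : Matrix (Fin 4) (Fin 4) ℝ :=
  !![A, B, 0, 0; B, C, 0, 0; 0, 0, a, 0; 0, 0, 0, a]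

/-- Invariance under rotations about the first axis, in infinitesimal form: a symmetric tensor
commuting with the generator has no mixed components with the 23-plane and is a scalar on that
plane. -/
theorem eq_axialMat_of_commute {N : Matrix (Fin 4) (Fin 4) ℝ} (hs : N.IsSymm)
    (hc : rotGen 2 * N - N * rotGen 2 = 0) :
    N = axialMat (N 0 0) (N 0 1) (N 1 1) (N 2 2) := by
  have h := fun i j => congrFun (congrFun hc i) j
  have h02 := h 0 2
  have h03 := h 0 3
  have h12 := h 1 2
  have h13 := h 1 3
  have h22 := h 2 2
  have h23 := h 2 3
  simp only [Matrix.sub_apply, Matrix.mul_apply, Matrix.zero_apply, Fin.sum_univ_four] at h02 h03 h12 h13 h22 h23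
  simp [rotGen] at h02 h03 h12 h13 h22 h23
  have s := fun i j => hs.apply i j
  have s1 := s 0 1
  have s2 := s 0 2
  have s3 := s 0 3
  have s4 := s 1 2
  have s5 := s 1 3
  have s6 := s 2 3
  ext i j
  fin_cases i <;> fin_cases j <;> simp [axialMat] <;> linarith

/-- `axisPt` is linear, so a line in the directions 0 and 1 through an axis point stays among the
axis points, where `u` vanishes. -/
theorem pd_eq_zero_of_axis {Ω : Set Coord} (hΩ : IsOpen Ω) {u : Coord → ℝ} {z : ℝ × ℝ}
    (hz : axisPt z ∈ Ω) (hu : DifferentiableAt ℝ u (axisPt z))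
    (h0 : ∀ w, axisPt w ∈ Ω → u (axisPt w) = 0) :
    pd 0 u (axisPt z) = 0 ∧ pd 1 u (axisPt z) = 0 := by
  have key : ∀ w : ℝ × ℝ, fderiv ℝ u (axisPt z) (axisPt w) = 0 := by
    intro w
    have e : ∀ s : ℝ, axisPt z + s • axisPt w = axisPt (z + s • w) := by
      intro s; ext i; fin_cases i <;> simp [axisPt]
    have hl := hu.hasFDerivAt.hasLineDerivAt (axisPt w)
    refine hl.unique ?_
    have hcont : Continuous fun s : ℝ => axisPt z + s • axisPt w := by fun_prop
    have : (fun s : ℝ => u (axisPt z + s • axisPt w)) =ᶠ[nhds 0] fun _ => 0 := by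
      have hm : Ω ∈ nhds (axisPt z + (0 : ℝ) • axisPt w) := by
        simpa using hΩ.mem_nhds hz
      filter_upwards [hcont.continuousAt.preimage_mem_nhds hm] with s hs
      rw [e]
      exact h0 _ (by rw [← e]; exact hs)
    exact (hasDerivAt_const (0 : ℝ) (0 : ℝ)).congr_of_eventuallyEq this
  constructor
  · have e : (Pi.single 0 1 : Coord) = axisPt (1, 0) := by ext i; fin_cases i <;> simp [axisPt]
    rw [pd, e, key]
  · have e : (Pi.single 1 1 : Coord) = axisPt (0, 1) := by ext i; fin_cases i <;> simp [axisPt]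
    rw [pd, e, key]

/-- The first two generators move an axis point in the directions 2 and 3 at rate `z.2`, so their
Killing equations yield the transverse derivatives of g. The third fixes the point, so its Killing
equation becomes a commutation relation. -/
theorem rotGen_mulVec_axisPt (z : ℝ × ℝ) :
    rotGen 0 *ᵥ axisPt z = ![0, 0, z.2, 0] ∧ rotGen 1 *ᵥ axisPt z = ![0, 0, 0, z.2] ∧
      rotGen 2 *ᵥ axisPt z = 0 := by
  refine ⟨?_, ?_, ?_⟩ <;> ext i <;> fin_cases i <;>
    simp [rotGen, axisPt, Matrix.mulVec, dotProduct, Fin.sum_univ_succ]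

namespace IsSphericallySymmetricSpacetime

variable {Ω : Set Coord} {g : MetricField} (hg : IsSphericallySymmetricSpacetime Ω g)
include hg

theorem isSymm {x : Coord} (hx : x ∈ Ω) : (g x).IsSymm := (hg.lorentzian x hx).1

theorem det_ne_zero {x : Coord} (hx : x ∈ Ω) : (g x).det ≠ 0 := by
  obtain ⟨-, P, hP, h⟩ := hg.lorentzian x hx
  intro h0
  have := congrArg Matrix.det h
  simp [Matrix.det_mul, h0, Fin.prod_univ_succ] at this

theorem differentiableAt {x : Coord} (hx : x ∈ Ω) (i j : Fin 4) :
    DifferentiableAt ℝ (fun x => g x i j) x :=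
  ((hg.smooth i j).contDiffAt (hg.isOpen.mem_nhds hx)).differentiableAt (by simp)

theorem differentiableAt_pdMat {x : Coord} (hx : x ∈ Ω) (k i j : Fin 4) :
    DifferentiableAt ℝ (fun x => pdMat k g x i j) x :=
  (((hg.smooth i j).pd hg.isOpen k).contDiffAt (hg.isOpen.mem_nhds hx)).differentiableAt (by simp)

theorem isSymm_pdMat {x : Coord} (hx : x ∈ Ω) (k : Fin 4) : (pdMat k g x).IsSymm := by
  ext i j
  refine pd_congr ?_
  filter_upwards [hg.isOpen.mem_nhds hx] with y hy using (hg.isSymm hy).apply i j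

theorem isSymm_pdMat_pdMat {x : Coord} (hx : x ∈ Ω) (m k : Fin 4) :
    (pdMat m (pdMat k g) x).IsSymm := by
  ext i j
  refine pd_congr ?_
  filter_upwards [hg.isOpen.mem_nhds hx] with y hy using (hg.isSymm_pdMat hy k).apply i j

theorem pdMat_comm {x : Coord} (hx : x ∈ Ω) (m k : Fin 4) :
    pdMat m (pdMat k g) x = pdMat k (pdMat m g) x := by
  ext i j
  exact pd_comm hg.isOpen (hg.smooth i j) hx m k

variable {z : ℝ × ℝ} (hz : axisPt z ∈ Ω)
include hz

theorem axis_ne_zero : z.2 ≠ 0 := by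
  intro h
  have := hg.radius_pos _ hz
  simp [radius, axisPt, h] at this

theorem metric_axis : g (axisPt z) = axialMat (g (axisPt z) 0 0) (g (axisPt z) 0 1)
    (g (axisPt z) 1 1) (g (axisPt z) 2 2) := by
  refine eq_axialMat_of_commute (hg.isSymm hz) ?_
  rw [← hg.killing_rotGen 2 hz, (rotGen_mulVec_axisPt z).2.2]
  simp

theorem pdMat_axis_commute (n : Fin 4) (hn : n = 0 ∨ n = 1) :
    rotGen 2 * pdMat n g (axisPt z) - pdMat n g (axisPt z) * rotGen 2 = 0 := by
  rw [← hg.pd_killing_rotGen 2 hz, (rotGen_mulVec_axisPt z).2.2]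
  -- Columns 0 and 1 of `rotGen 2` are zero, so the derivative of the rotation field contributes
  -- nothing in these directions.
  rcases hn with rfl | rfl <;> simp [rotGen, Fin.sum_univ_succ]

theorem pdMat_axis (n : Fin 4) (hn : n = 0 ∨ n = 1) : pdMat n g (axisPt z) =
    axialMat (pdMat n g (axisPt z) 0 0) (pdMat n g (axisPt z) 0 1)
      (pdMat n g (axisPt z) 1 1) (pdMat n g (axisPt z) 2 2) :=
  eq_axialMat_of_commute (hg.isSymm_pdMat hz n) (hg.pdMat_axis_commute hz n hn)

/-- The commutator of `rotGen 2` with `pdMat n g` vanishes at every axis point, hence so do its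
derivatives in the directions 0 and 1; these are the commutators with the second derivatives. -/
theorem pdMat_pdMat_axis (m n : Fin 4) (hm : m = 0 ∨ m = 1) (hn : n = 0 ∨ n = 1) :
    pdMat m (pdMat n g) (axisPt z) =
    axialMat (pdMat m (pdMat n g) (axisPt z) 0 0) (pdMat m (pdMat n g) (axisPt z) 0 1)
      (pdMat m (pdMat n g) (axisPt z) 1 1) (pdMat m (pdMat n g) (axisPt z) 2 2) := by
  refine eq_axialMat_of_commute (hg.isSymm_pdMat_pdMat hz m n) ?_
  ext i j
  have dD := hg.differentiableAt_pdMat hz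
  have h := pd_eq_zero_of_axis (u := fun y => ∑ l, rotGen 2 i l * pdMat n g y l j
    - ∑ l, rotGen 2 l j * pdMat n g y i l) hg.isOpen hz (by fun_prop (disch := exact dD _ _ _)) (by
      intro w hw
      have := congrFun (congrFun (hg.pdMat_axis_commute hw n hn) i) j
      simp only [Matrix.sub_apply, Matrix.mul_apply, Matrix.zero_apply] at this
      rw [← this]
      congr 1
      exact Finset.sum_congr rfl fun _ _ => mul_comm _ _)
  have e : pd m (fun y => ∑ l, rotGen 2 i l * pdMat n g y l j
    - ∑ l, rotGen 2 l j * pdMat n g y i l) (axisPt z) = 0 := by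
    rcases hm with rfl | rfl
    exacts [h.1, h.2]
  rw [pd_sub, pd_sum, pd_sum] at e
  · simp only [pd_const_mul (dD _ _ _)] at e
    simp only [Matrix.sub_apply, Matrix.mul_apply, Matrix.zero_apply]
    rw [← e]
    congr 1
    exact Finset.sum_congr rfl fun _ _ => mul_comm _ _
  · exact fun l _ => (dD _ _ _).const_mul _
  · exact fun l _ => (dD _ _ _).const_mul _
  · exact DifferentiableAt.fun_sum fun l _ => (dD _ _ _).const_mul _
  · exact DifferentiableAt.fun_sum fun l _ => (dD _ _ _).const_mul _

theorem pdMat_two_axis : pdMat 2 g (axisPt z) =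
    z.2⁻¹ • (rotGen 0 * g (axisPt z) - g (axisPt z) * rotGen 0) := by
  have h := hg.killing_rotGen 0 hz
  rw [(rotGen_mulVec_axisPt z).1] at h
  simp only [Fin.sum_univ_four] at h
  simp at h
  rw [← h, smul_smul, inv_mul_cancel₀ (hg.axis_ne_zero hz), one_smul]

theorem pdMat_three_axis : pdMat 3 g (axisPt z) =
    z.2⁻¹ • (rotGen 1 * g (axisPt z) - g (axisPt z) * rotGen 1) := by
  have h := hg.killing_rotGen 1 hz
  rw [(rotGen_mulVec_axisPt z).2.1] at h
  simp only [Fin.sum_univ_four] at h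
  simp at h
  rw [← h, smul_smul, inv_mul_cancel₀ (hg.axis_ne_zero hz), one_smul]

/-- The differentiated Killing equation, solved for the second derivative, which carries the
coefficient `z.2`. The last sum comes from differentiating the rotation field itself. -/
theorem pdMat_pdMat_two_axis (n : Fin 4) : pdMat n (pdMat 2 g) (axisPt z) =
    z.2⁻¹ • (rotGen 0 * pdMat n g (axisPt z) - pdMat n g (axisPt z) * rotGen 0
      - ∑ k, rotGen 0 k n • pdMat k g (axisPt z)) := by
  have h := hg.pd_killing_rotGen 0 hz n
  rw [Finset.sum_add_distrib, (rotGen_mulVec_axisPt z).1] at h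
  rw [← h, add_sub_cancel_left, Fin.sum_univ_four]
  simp [smul_smul, inv_mul_cancel₀ (hg.axis_ne_zero hz)]

theorem pdMat_pdMat_three_axis (n : Fin 4) : pdMat n (pdMat 3 g) (axisPt z) =
    z.2⁻¹ • (rotGen 1 * pdMat n g (axisPt z) - pdMat n g (axisPt z) * rotGen 1
      - ∑ k, rotGen 1 k n • pdMat k g (axisPt z)) := by
  have h := hg.pd_killing_rotGen 1 hz n
  rw [Finset.sum_add_distrib, (rotGen_mulVec_axisPt z).2.1] at h
  rw [← h, add_sub_cancel_left, Fin.sum_univ_four]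
  simp [smul_smul, inv_mul_cancel₀ (hg.axis_ne_zero hz)]

end IsSphericallySymmetricSpacetime

/-! ### Ricci components at an axis point -/

/-- The components of a symmetric tensor of type `(B, C)` with respect to the second axis. -/
def offMat2 (b c : ℝ) : Matrix (Fin 4) (Fin 4) ℝ :=
  !![0, 0, b, 0; 0, 0, c, 0; b, c, 0, 0; 0, 0, 0, 0]

/-- The components of a symmetric tensor of type `(B, C)` with respect to the third axis. -/
def offMat3 (b c : ℝ) : Matrix (Fin 4) (Fin 4) ℝ :=
  !![0, 0, 0, b; 0, 0, 0, c; 0, 0, 0, 0; b, c, 0, 0]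

/-- The Riemann component `R_{0101}` of the metric `A dt² + 2 B dt dr + C dr²` with the inverse
metric `p, q, s`. -/
def riem2 (p q s A0 B0 C0 A1 B1 C1 A11 B01 C00 : ℝ) : ℝ :=
  B01 - A11 / 2 - C00 / 2
    + (p * (A1 / 2) * (A1 / 2) + 2 * q * (A1 / 2) * (C0 / 2) + s * (C0 / 2) * (C0 / 2))
    - (p * (B1 - C0 / 2) * (A0 / 2) + q * ((B1 - C0 / 2) * (B0 - A1 / 2) + (C1 / 2) * (A0 / 2))
      + s * (C1 / 2) * (B0 - A1 / 2))

/-- The component `2 (∇_0 ∇_0 R) / R` for `R ^ 2 = r ^ 2 a`, where `e = 1 / a` and `ρ = 1 / r`. -/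
def hess00 (p q s e ρ A0 B0 A1 a0 a1 a00 : ℝ) : ℝ :=
  a00 * e - (a0 * e) ^ 2 / 2
    - ((p * (A0 / 2) + q * (B0 - A1 / 2)) * (a0 * e)
      + (q * (A0 / 2) + s * (B0 - A1 / 2)) * (a1 * e + 2 * ρ))

/-- The component `2 (∇_0 ∇_1 R) / R` for `R ^ 2 = r ^ 2 a`, where `e = 1 / a` and `ρ = 1 / r`. -/
def hess01 (p q s e ρ C0 A1 a0 a1 a01 : ℝ) : ℝ :=
  a01 * e + 2 * a0 * ρ * e - (a0 * e) * (a1 * e + 2 * ρ) / 2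
    - ((p * (A1 / 2) + q * (C0 / 2)) * (a0 * e)
      + (q * (A1 / 2) + s * (C0 / 2)) * (a1 * e + 2 * ρ))

/-- The component `2 (∇_1 ∇_1 R) / R` for `R ^ 2 = r ^ 2 a`, where `e = 1 / a` and `ρ = 1 / r`. -/
def hess11 (p q s e ρ C0 B1 C1 a0 a1 a11 : ℝ) : ℝ :=
  a11 * e + 4 * a1 * ρ * e + 2 * ρ ^ 2 - (a1 * e + 2 * ρ) ^ 2 / 2
    - ((p * (B1 - C0 / 2) + q * (C1 / 2)) * (a0 * e)
      + (q * (B1 - C0 / 2) + s * (C1 / 2)) * (a1 * e + 2 * ρ))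

/-- The first and second derivatives of a spherically symmetric metric at a point of the first axis
at distance `1 / ρ` from the origin, in terms of the derivatives in the directions `0` and `1`. -/
structure AxialData (A B C a A0 B0 C0 a0 A1 B1 C1 a1 ρ : ℝ)
    (A00 B00 C00 a00 A01 B01 C01 a01 A11 B11 C11 a11 : ℝ)
    (D : Fin 4 → Matrix (Fin 4) (Fin 4) ℝ) (H : Fin 4 → Fin 4 → Matrix (Fin 4) (Fin 4) ℝ) :
    Prop where
  D0 : D 0 = axialMat A0 B0 C0 a0
  D1 : D 1 = axialMat A1 B1 C1 a1
  D2 : D 2 = offMat2 (B * ρ) ((C - a) * ρ)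
  D3 : D 3 = offMat3 (B * ρ) ((C - a) * ρ)
  H00 : H 0 0 = axialMat A00 B00 C00 a00
  H01 : H 0 1 = axialMat A01 B01 C01 a01
  H10 : H 1 0 = axialMat A01 B01 C01 a01
  H11 : H 1 1 = axialMat A11 B11 C11 a11
  H02 : H 0 2 = offMat2 (B0 * ρ) ((C0 - a0) * ρ)
  H20 : H 2 0 = offMat2 (B0 * ρ) ((C0 - a0) * ρ)
  H03 : H 0 3 = offMat3 (B0 * ρ) ((C0 - a0) * ρ)
  H30 : H 3 0 = offMat3 (B0 * ρ) ((C0 - a0) * ρ)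
  H12 : H 1 2 = offMat2 (B1 * ρ - B * ρ ^ 2) ((C1 - a1) * ρ - (C - a) * ρ ^ 2)
  H21 : H 2 1 = offMat2 (B1 * ρ - B * ρ ^ 2) ((C1 - a1) * ρ - (C - a) * ρ ^ 2)
  H13 : H 1 3 = offMat3 (B1 * ρ - B * ρ ^ 2) ((C1 - a1) * ρ - (C - a) * ρ ^ 2)
  H31 : H 3 1 = offMat3 (B1 * ρ - B * ρ ^ 2) ((C1 - a1) * ρ - (C - a) * ρ ^ 2)
  H22 : H 2 2 = !![A1 * ρ, B1 * ρ - B * ρ ^ 2, 0, 0;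
    B1 * ρ - B * ρ ^ 2, C1 * ρ - 2 * (C - a) * ρ ^ 2, 0, 0;
    0, 0, a1 * ρ + 2 * (C - a) * ρ ^ 2, 0; 0, 0, 0, a1 * ρ]
  H33 : H 3 3 = !![A1 * ρ, B1 * ρ - B * ρ ^ 2, 0, 0;
    B1 * ρ - B * ρ ^ 2, C1 * ρ - 2 * (C - a) * ρ ^ 2, 0, 0;
    0, 0, a1 * ρ, 0; 0, 0, 0, a1 * ρ + 2 * (C - a) * ρ ^ 2]
  H23 : H 2 3 = !![0, 0, 0, 0; 0, 0, 0, 0; 0, 0, 0, (C - a) * ρ ^ 2; 0, 0, (C - a) * ρ ^ 2, 0]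
  H32 : H 3 2 = !![0, 0, 0, 0; 0, 0, 0, 0; 0, 0, 0, (C - a) * ρ ^ 2; 0, 0, (C - a) * ρ ^ 2, 0]

namespace AxialData

variable {A B C a A0 B0 C0 a0 A1 B1 C1 a1 ρ : ℝ}
    {A00 B00 C00 a00 A01 B01 C01 a01 A11 B11 C11 a11 : ℝ}
    {D : Fin 4 → Matrix (Fin 4) (Fin 4) ℝ} {H : Fin 4 → Fin 4 → Matrix (Fin 4) (Fin 4) ℝ}
    (h : AxialData A B C a A0 B0 C0 a0 A1 B1 C1 a1 ρ
      A00 B00 C00 a00 A01 B01 C01 a01 A11 B11 C11 a11 D H)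
    (p q s e : ℝ)
include h

/-- The warped product formula Ric_ab = Ric(h)_ab - 2∇_a∇_bR / R, where in two dimensions Ric(h)_00
= h¹¹ R_0101. Here `p, q, s` is the inverse of h and `e` that of `a`; the inverse relations remove
the excess terms in `ρ` left by the Cartesian transverse derivatives. -/
theorem ricciExpr_zero_zero (hqB : q * B + s * C = 1)
    (hpB : p * B + q * C = 0) (he : e * a = 1) :
    ricciExpr (axialMat p q s e) D H 0 0 =
      s * riem2 p q s A0 B0 C0 A1 B1 C1 A11 B01 C00 - hess00 p q s e ρ A0 B0 A1 a0 a1 a00 := by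
  simp [ricciExpr, Fin.sum_univ_four, h.D0, h.D1, h.D2, h.D3, h.H00, h.H01, h.H10, h.H11, h.H02,
    h.H20, h.H03, h.H30, h.H12, h.H21, h.H13, h.H31, h.H22, h.H33, h.H23, h.H32]
  simp [axialMat, offMat2, offMat3, riem2, hess00]
  linear_combination (-e * ρ * A0) * hpB + (ρ * q * A0 + ρ * s * (2 * B0 - A1)) * he
    - e * ρ * (2 * B0 - A1) * hqB

theorem ricciExpr_zero_one (hqB : q * B + s * C = 1)
    (hpB : p * B + q * C = 0) (he : e * a = 1) :
    ricciExpr (axialMat p q s e) D H 0 1 =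
      -q * riem2 p q s A0 B0 C0 A1 B1 C1 A11 B01 C00 - hess01 p q s e ρ C0 A1 a0 a1 a01 := by
  simp [ricciExpr, Fin.sum_univ_four, h.D0, h.D1, h.D2, h.D3, h.H00, h.H01, h.H10, h.H11, h.H02,
    h.H20, h.H03, h.H30, h.H12, h.H21, h.H13, h.H31, h.H22, h.H33, h.H23, h.H32]
  simp [axialMat, offMat2, offMat3, riem2, hess01]
  grind

theorem ricciExpr_one_one (hqB : q * B + s * C = 1)
    (hpB : p * B + q * C = 0) (he : e * a = 1) :
    ricciExpr (axialMat p q s e) D H 1 1 =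
      p * riem2 p q s A0 B0 C0 A1 B1 C1 A11 B01 C00 - hess11 p q s e ρ C0 B1 C1 a0 a1 a11 := by
  simp [ricciExpr, Fin.sum_univ_four, h.D0, h.D1, h.D2, h.D3, h.H00, h.H01, h.H10, h.H11, h.H02,
    h.H20, h.H03, h.H30, h.H12, h.H21, h.H13, h.H31, h.H22, h.H33, h.H23, h.H32]
  simp [axialMat, offMat2, offMat3, riem2, hess11]
  grind

/-- The angular part of the warped product formula, Ric = (1 - |∇R|² - R□R) dΩ². The direction 2 has
squared length `ρ ^ 2` for dΩ², and R²ρ² = a. -/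
theorem ricciExpr_two_two (hqB : q * B + s * C = 1)
    (hpB : p * B + q * C = 0) (he : e * a = 1) :
    ricciExpr (axialMat p q s e) D H 2 2 =
      ρ ^ 2 - a * ((p * (a0 * e) ^ 2 + 2 * q * (a0 * e) * (a1 * e + 2 * ρ)
          + s * (a1 * e + 2 * ρ) ^ 2) / 4
        + (p * hess00 p q s e ρ A0 B0 A1 a0 a1 a00 + 2 * q * hess01 p q s e ρ C0 A1 a0 a1 a01
          + s * hess11 p q s e ρ C0 B1 C1 a0 a1 a11) / 2) := by
  simp [ricciExpr, Fin.sum_univ_four, h.D0, h.D1, h.D2, h.D3, h.H00, h.H01, h.H10, h.H11, h.H02,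
    h.H20, h.H03, h.H30, h.H12, h.H21, h.H13, h.H31, h.H22, h.H33, h.H23, h.H32]
  simp [axialMat, offMat2, offMat3, hess00, hess01, hess11]
  grind

end AxialData

/-! ### The reduced Einstein equations in the plane: mass and time form -/

/-- The derivative of a function on the plane in the direction `v`. -/
def dirDeriv (v : ℝ × ℝ) (u : ℝ × ℝ → ℝ) (z : ℝ × ℝ) : ℝ := fderiv ℝ u z v

/-- The derivative with respect to the first variable. -/
abbrev dt : (ℝ × ℝ → ℝ) → ℝ × ℝ → ℝ := dirDeriv (1, 0)

/-- The derivative with respect to the second variable. -/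
abbrev dr : (ℝ × ℝ → ℝ) → ℝ × ℝ → ℝ := dirDeriv (0, 1)

theorem dirDeriv_add {v z : ℝ × ℝ} {f h : ℝ × ℝ → ℝ} (hf : DifferentiableAt ℝ f z)
    (hh : DifferentiableAt ℝ h z) :
    dirDeriv v (fun y => f y + h y) z = dirDeriv v f z + dirDeriv v h z := by
  simp only [dirDeriv]; rw [fderiv_fun_add hf hh]; rfl

theorem dirDeriv_sub {v z : ℝ × ℝ} {f h : ℝ × ℝ → ℝ} (hf : DifferentiableAt ℝ f z)
    (hh : DifferentiableAt ℝ h z) :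
    dirDeriv v (fun y => f y - h y) z = dirDeriv v f z - dirDeriv v h z := by
  simp only [dirDeriv]; rw [fderiv_fun_sub hf hh]; rfl

theorem dirDeriv_mul {v z : ℝ × ℝ} {f h : ℝ × ℝ → ℝ} (hf : DifferentiableAt ℝ f z)
    (hh : DifferentiableAt ℝ h z) :
    dirDeriv v (fun y => f y * h y) z = dirDeriv v f z * h z + f z * dirDeriv v h z := by
  simp only [dirDeriv]; rw [fderiv_fun_mul hf hh]; simp; ring

theorem dirDeriv_const {v z : ℝ × ℝ} {c : ℝ} : dirDeriv v (fun _ => c) z = 0 := by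
  simp [dirDeriv]

theorem dirDeriv_congr {D : Set (ℝ × ℝ)} (hD : IsOpen D) {v z : ℝ × ℝ} {f h : ℝ × ℝ → ℝ}
    (hz : z ∈ D) (e : ∀ y ∈ D, f y = h y) : dirDeriv v f z = dirDeriv v h z := by
  have : f =ᶠ[nhds z] h := by filter_upwards [hD.mem_nhds hz] with y hy using e y hy
  simp only [dirDeriv]; rw [this.fderiv_eq]

theorem ContDiffOn.dirDeriv {D : Set (ℝ × ℝ)} (hD : IsOpen D) {f : ℝ × ℝ → ℝ}
    (hf : ContDiffOn ℝ ∞ f D) (v : ℝ × ℝ) : ContDiffOn ℝ ∞ (dirDeriv v f) D :=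
  ((contDiffOn_infty_iff_fderiv_of_isOpen hD).1 hf).2.clm_apply contDiffOn_const

theorem ContDiffOn.differentiableAt_of_mem {E : Type*} [NormedAddCommGroup E] [NormedSpace ℝ E]
    {F : Type*} [NormedAddCommGroup F] [NormedSpace ℝ F]
    {D : Set E} (hD : IsOpen D) {f : E → F}
    (hf : ContDiffOn ℝ ∞ f D) {z : E} (hz : z ∈ D) : DifferentiableAt ℝ f z :=
  (hf.contDiffAt (hD.mem_nhds hz)).differentiableAt (by simp)

theorem dirDeriv_comm {D : Set (ℝ × ℝ)} (hD : IsOpen D) {f : ℝ × ℝ → ℝ} (hf : ContDiffOn ℝ ∞ f D)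
    {z : ℝ × ℝ} (hz : z ∈ D) (v w : ℝ × ℝ) :
    dirDeriv v (dirDeriv w f) z = dirDeriv w (dirDeriv v f) z := by
  have h := (contDiffOn_infty_iff_fderiv_of_isOpen hD).1 hf
  have hd := h.2.differentiableAt_of_mem hD hz
  have hs : IsSymmSndFDerivAt ℝ f z :=
    (hf.contDiffAt (hD.mem_nhds hz)).isSymmSndFDerivAt (by
      simp only [minSmoothness_of_isRCLikeNormedField]
      exact WithTop.coe_le_coe.2 le_top)
  have key : ∀ a b : ℝ × ℝ, fderiv ℝ (fun y => fderiv ℝ f y a) z b =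
      fderiv ℝ (fderiv ℝ f) z b a := by
    intro a b
    rw [fderiv_clm_apply hd (differentiableAt_const a)]
    simp
  change fderiv ℝ (fun y => fderiv ℝ f y _) z _ = fderiv ℝ (fun y => fderiv ℝ f y _) z _
  rw [key, key]
  exact hs _ _

section Metric2

variable (A B C R : ℝ × ℝ → ℝ)

/-- Minus the determinant of the metric `A dt² + 2 B dt dr + C dr²`. -/
def negDet (z : ℝ × ℝ) : ℝ := B z ^ 2 - A z * C z

/-- The first component of the gradient of `R`. -/
def gradT (z : ℝ × ℝ) : ℝ := (-C z * dt R z + B z * dr R z) / negDet A B C z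

/-- The second component of the gradient of `R`. -/
def gradR (z : ℝ × ℝ) : ℝ := (B z * dt R z - A z * dr R z) / negDet A B C z

/-- The squared norm of the gradient of `R`. -/
def gradNormSq (z : ℝ × ℝ) : ℝ := gradT A B C R z * dt R z + gradR A B C R z * dr R z

/-- A Lorentzian metric `A dt² + 2 B dt dr + C dr²` on a connected plane domain with a positive
function `R` satisfying the reduced Einstein equations
`2 R ∇∇R = (1 - |∇R|² - Λ R²) h`. -/
structure IsReducedEinstein (Λ : ℝ) (D : Set (ℝ × ℝ)) : Prop where
  isOpen : IsOpen D
  isPreconnected : IsPreconnected D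
  smooth_A : ContDiffOn ℝ ∞ A D
  smooth_B : ContDiffOn ℝ ∞ B D
  smooth_C : ContDiffOn ℝ ∞ C D
  smooth_R : ContDiffOn ℝ ∞ R D
  negDet_pos : ∀ z ∈ D, 0 < negDet A B C z
  R_pos : ∀ z ∈ D, 0 < R z
  hess_tt : ∀ z ∈ D, 2 * R z * (dt (dt R) z - (dt A z / 2 * gradT A B C R z
      + (dt B z - dr A z / 2) * gradR A B C R z)) =
    (1 - gradNormSq A B C R z - Λ * R z ^ 2) * A z
  hess_tr : ∀ z ∈ D, 2 * R z * (dr (dt R) z - (dr A z / 2 * gradT A B C R z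
      + dt C z / 2 * gradR A B C R z)) =
    (1 - gradNormSq A B C R z - Λ * R z ^ 2) * B z
  hess_rr : ∀ z ∈ D, 2 * R z * (dr (dr R) z - ((dr B z - dt C z / 2) * gradT A B C R z
      + dr C z / 2 * gradR A B C R z)) =
    (1 - gradNormSq A B C R z - Λ * R z ^ 2) * C z

end Metric2

namespace IsReducedEinstein

variable {A B C R : ℝ × ℝ → ℝ} {Λ : ℝ} {D : Set (ℝ × ℝ)} (h : IsReducedEinstein A B C R Λ D)
include h

theorem smooth_negDet : ContDiffOn ℝ ∞ (negDet A B C) D :=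
  (h.smooth_B.pow 2).sub (h.smooth_A.mul h.smooth_C)

theorem smooth_gradT : ContDiffOn ℝ ∞ (gradT A B C R) D :=
  ((h.smooth_C.neg.mul (h.smooth_R.dirDeriv h.isOpen _)).add
    (h.smooth_B.mul (h.smooth_R.dirDeriv h.isOpen _))).div h.smooth_negDet
    fun z hz => (h.negDet_pos z hz).ne'

theorem smooth_gradR : ContDiffOn ℝ ∞ (gradR A B C R) D :=
  ((h.smooth_B.mul (h.smooth_R.dirDeriv h.isOpen _)).sub
    (h.smooth_A.mul (h.smooth_R.dirDeriv h.isOpen _))).div h.smooth_negDet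
    fun z hz => (h.negDet_pos z hz).ne'

theorem smooth_gradNormSq : ContDiffOn ℝ ∞ (gradNormSq A B C R) D :=
  (h.smooth_gradT.mul (h.smooth_R.dirDeriv h.isOpen _)).add
    (h.smooth_gradR.mul (h.smooth_R.dirDeriv h.isOpen _))

theorem lower_t {z : ℝ × ℝ} (hz : z ∈ D) :
    A z * gradT A B C R z + B z * gradR A B C R z = dt R z := by
  have := (h.negDet_pos z hz).ne'
  simp only [gradT, gradR]
  field_simp
  simp only [negDet]; ring

theorem lower_r {z : ℝ × ℝ} (hz : z ∈ D) :
    B z * gradT A B C R z + C z * gradR A B C R z = dr R z := by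
  have := (h.negDet_pos z hz).ne'
  simp only [gradT, gradR]
  field_simp
  simp only [negDet]; ring

theorem dirDeriv_lower_t {z : ℝ × ℝ} (hz : z ∈ D) (v : ℝ × ℝ) :
    dirDeriv v A z * gradT A B C R z + A z * dirDeriv v (gradT A B C R) z
      + (dirDeriv v B z * gradR A B C R z + B z * dirDeriv v (gradR A B C R) z)
      = dirDeriv v (dt R) z := by
  have dA := h.smooth_A.differentiableAt_of_mem h.isOpen hz
  have dB := h.smooth_B.differentiableAt_of_mem h.isOpen hz
  have d1 := h.smooth_gradT.differentiableAt_of_mem h.isOpen hz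
  have d2 := h.smooth_gradR.differentiableAt_of_mem h.isOpen hz
  rw [← dirDeriv_mul dA d1, ← dirDeriv_mul dB d2, ← dirDeriv_add (dA.fun_mul d1) (dB.fun_mul d2)]
  exact dirDeriv_congr h.isOpen hz fun y hy => h.lower_t hy

theorem dirDeriv_lower_r {z : ℝ × ℝ} (hz : z ∈ D) (v : ℝ × ℝ) :
    dirDeriv v B z * gradT A B C R z + B z * dirDeriv v (gradT A B C R) z
      + (dirDeriv v C z * gradR A B C R z + C z * dirDeriv v (gradR A B C R) z)
      = dirDeriv v (dr R) z := by
  have dA := h.smooth_B.differentiableAt_of_mem h.isOpen hz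
  have dB := h.smooth_C.differentiableAt_of_mem h.isOpen hz
  have d1 := h.smooth_gradT.differentiableAt_of_mem h.isOpen hz
  have d2 := h.smooth_gradR.differentiableAt_of_mem h.isOpen hz
  rw [← dirDeriv_mul dA d1, ← dirDeriv_mul dB d2, ← dirDeriv_add (dA.fun_mul d1) (dB.fun_mul d2)]
  exact dirDeriv_congr h.isOpen hz fun y hy => h.lower_r hy

/-- Differentiating the lowering relations h∇R = dR instead of the quotients in `gradT` and `gradR`
leaves ∂N = 2∇R·∂(dR) - (∂h)(∇R,∇R), without derivatives of the inverse metric. -/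
theorem dirDeriv_gradNormSq {z : ℝ × ℝ} (hz : z ∈ D) (v : ℝ × ℝ) :
    dirDeriv v (gradNormSq A B C R) z =
      2 * (gradT A B C R z * dirDeriv v (dt R) z + gradR A B C R z * dirDeriv v (dr R) z)
      - (dirDeriv v A z * gradT A B C R z ^ 2
        + 2 * dirDeriv v B z * gradT A B C R z * gradR A B C R z
        + dirDeriv v C z * gradR A B C R z ^ 2) := by
  have d1 := h.smooth_gradT.differentiableAt_of_mem h.isOpen hz
  have d2 := h.smooth_gradR.differentiableAt_of_mem h.isOpen hz
  have d3 := (h.smooth_R.dirDeriv h.isOpen (1, 0)).differentiableAt_of_mem h.isOpen hz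
  have d4 := (h.smooth_R.dirDeriv h.isOpen (0, 1)).differentiableAt_of_mem h.isOpen hz
  have e : dirDeriv v (gradNormSq A B C R) z =
      dirDeriv v (gradT A B C R) z * dt R z + gradT A B C R z * dirDeriv v (dt R) z
      + (dirDeriv v (gradR A B C R) z * dr R z + gradR A B C R z * dirDeriv v (dr R) z) := by
    rw [← dirDeriv_mul d1 d3, ← dirDeriv_mul d2 d4,
      ← dirDeriv_add (d1.fun_mul d3) (d2.fun_mul d4)]
    rfl
  rw [e, ← h.lower_t hz, ← h.lower_r hz]
  linear_combination gradT A B C R z * h.dirDeriv_lower_t hz v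
    + gradR A B C R z * h.dirDeriv_lower_r hz v

/-- This is dN = 2∇∇R(∇R, ·) with the Hessian equations contracted against ∇R. -/
theorem dt_gradNormSq {z : ℝ × ℝ} (hz : z ∈ D) : R z * dt (gradNormSq A B C R) z =
    (1 - gradNormSq A B C R z - Λ * R z ^ 2) * dt R z := by
  have e := h.dirDeriv_gradNormSq hz (1, 0)
  rw [dt, e, dirDeriv_comm h.isOpen h.smooth_R hz (1, 0) (0, 1)]
  linear_combination (1 - gradNormSq A B C R z - Λ * R z ^ 2) * h.lower_t hz
    + gradT A B C R z * h.hess_tt z hz + gradR A B C R z * h.hess_tr z hz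

theorem dr_gradNormSq {z : ℝ × ℝ} (hz : z ∈ D) : R z * dr (gradNormSq A B C R) z =
    (1 - gradNormSq A B C R z - Λ * R z ^ 2) * dr R z := by
  have e := h.dirDeriv_gradNormSq hz (0, 1)
  rw [dr, e]
  linear_combination (1 - gradNormSq A B C R z - Λ * R z ^ 2) * h.lower_r hz
    + gradT A B C R z * h.hess_tr z hz + gradR A B C R z * h.hess_rr z hz

theorem exists_mass : ∃ M : ℝ, ∀ z ∈ D, gradNormSq A B C R z = sdsF M (Λ / 6) (R z) := by
  -- Twice the mass: N = 1 - 2M/R - ΛR²/3 solved for 2M.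
  let m : ℝ × ℝ → ℝ := fun z => R z * (1 - gradNormSq A B C R z) - Λ / 3 * (R z * (R z * R z))
  have dm : ∀ z ∈ D, ∀ v, dirDeriv v m z =
      dirDeriv v R z * (1 - gradNormSq A B C R z) - R z * dirDeriv v (gradNormSq A B C R) z
        - Λ * R z ^ 2 * dirDeriv v R z := by
    intro z hz v
    have d1 := h.smooth_R.differentiableAt_of_mem h.isOpen hz
    have d2 := h.smooth_gradNormSq.differentiableAt_of_mem h.isOpen hz
    have dc : ∀ c : ℝ, DifferentiableAt ℝ (fun _ : ℝ × ℝ => c) z := differentiableAt_const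
    simp only [m]
    rw [dirDeriv_sub (d1.fun_mul ((dc _).fun_sub d2))
        ((dc _).fun_mul (d1.fun_mul (d1.fun_mul d1))),
      dirDeriv_mul d1 ((dc _).fun_sub d2), dirDeriv_sub (dc _) d2,
      dirDeriv_mul (dc _) (d1.fun_mul (d1.fun_mul d1)), dirDeriv_mul d1 (d1.fun_mul d1),
      dirDeriv_mul d1 d1, dirDeriv_const, dirDeriv_const]
    ring
  have sm : DifferentiableOn ℝ m D := by
    have d1 := h.smooth_R.differentiableOn (by simp)
    have d2 := h.smooth_gradNormSq.differentiableOn (by simp)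
    simp only [m]
    fun_prop
  have fm : D.EqOn (fderiv ℝ m) 0 := by
    intro z hz
    have h0 : dt m z = 0 := by
      rw [dt, dm z hz]; linear_combination -h.dt_gradNormSq hz
    have h1 : dr m z = 0 := by
      rw [dr, dm z hz]; linear_combination -h.dr_gradNormSq hz
    refine ContinuousLinearMap.ext fun w => ?_
    have hw : w = w.1 • ((1, 0) : ℝ × ℝ) + w.2 • ((0, 1) : ℝ × ℝ) := by ext <;> simp
    rw [hw, map_add, map_smul, map_smul]
    simp only [dt, dr, dirDeriv] at h0 h1
    simp [h0, h1]
  obtain ⟨a, ha⟩ := h.isOpen.exists_is_const_of_fderiv_eq_zero h.isPreconnected sm fm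
  refine ⟨a / 2, fun z hz => ?_⟩
  have := h.R_pos z hz
  have e := ha z hz
  simp only [m] at e
  simp only [sdsF]
  field_simp
  linear_combination -6 * e

/-- The h-trace of the Hessian equations is R□R = 1 - N - ΛR². Here □R is the divergence of ∇R for
the density √`negDet`, and both sides are multiplied by 2·`negDet` to avoid roots. -/
theorem divergence {z : ℝ × ℝ} (hz : z ∈ D) :
    R z * (dr (negDet A B C) z * gradR A B C R z + dt (negDet A B C) z * gradT A B C R z
      + 2 * negDet A B C z * (dt (gradT A B C R) z + dr (gradR A B C R) z)) =
    2 * (1 - gradNormSq A B C R z - Λ * R z ^ 2) * negDet A B C z := by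
  have dA := h.smooth_A.differentiableAt_of_mem h.isOpen hz
  have dB := h.smooth_B.differentiableAt_of_mem h.isOpen hz
  have dC := h.smooth_C.differentiableAt_of_mem h.isOpen hz
  have e : ∀ v, dirDeriv v (negDet A B C) z =
      2 * B z * dirDeriv v B z - (dirDeriv v A z * C z + A z * dirDeriv v C z) := by
    intro v
    have : negDet A B C = fun y => B y * B y - A y * C y := by
      funext y; simp only [negDet]; ring
    rw [this, dirDeriv_sub (dB.fun_mul dB) (dA.fun_mul dC), dirDeriv_mul dB dB,
      dirDeriv_mul dA dC]
    ring
  have t1 := h.dirDeriv_lower_t hz (1, 0)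
  have t2 := h.dirDeriv_lower_r hz (1, 0)
  have r1 := h.dirDeriv_lower_t hz (0, 1)
  have r2 := h.dirDeriv_lower_r hz (0, 1)
  rw [dirDeriv_comm h.isOpen h.smooth_R hz (1, 0) (0, 1)] at t2
  have e1 := h.hess_tt z hz
  have e2 := h.hess_tr z hz
  have e3 := h.hess_rr z hz
  simp only [dt, dr] at *
  rw [e, e]
  simp only [negDet]
  linear_combination 2 * R z * (-C z * t1 + B z * t2 + B z * r1 - A z * r2)
    - C z * e1 + 2 * B z * e2 - A z * e3

/-- The components of the closed form `dT = ⋆dR / |∇R|²`. -/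
theorem timeForm_closed {U : Set (ℝ × ℝ)} (hU : IsOpen U) (hUD : U ⊆ D)
    (hN : ∀ z ∈ U, gradNormSq A B C R z ≠ 0) :
    ContDiffOn ℝ ∞ (fun z => √(negDet A B C z) * gradR A B C R z / gradNormSq A B C R z) U ∧
    ContDiffOn ℝ ∞ (fun z => -(√(negDet A B C z) * gradT A B C R z / gradNormSq A B C R z)) U ∧
    ∀ z ∈ U, dr (fun z => √(negDet A B C z) * gradR A B C R z / gradNormSq A B C R z) z =
      dt (fun z => -(√(negDet A B C z) * gradT A B C R z / gradNormSq A B C R z)) z := by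
  have sk : ContDiffOn ℝ ∞ (fun z => √(negDet A B C z)) U :=
    (h.smooth_negDet.mono hUD).sqrt fun z hz => (h.negDet_pos z (hUD hz)).ne'
  have s1 := h.smooth_gradT.mono hUD
  have s2 := h.smooth_gradR.mono hUD
  have sN := h.smooth_gradNormSq.mono hUD
  have c0 : ContDiffOn ℝ ∞
      (fun z => √(negDet A B C z) * gradR A B C R z / gradNormSq A B C R z) U :=
    (sk.mul s2).div sN hN
  have c1 : ContDiffOn ℝ ∞
      (fun z => -(√(negDet A B C z) * gradT A B C R z / gradNormSq A B C R z)) U :=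
    ((sk.mul s1).div sN hN).neg
  refine ⟨c0, c1, fun z hz => ?_⟩
  have dk := sk.differentiableAt_of_mem hU hz
  have d1 := s1.differentiableAt_of_mem hU hz
  have d2 := s2.differentiableAt_of_mem hU hz
  have dN := sN.differentiableAt_of_mem hU hz
  have hkpos : 0 < √(negDet A B C z) := Real.sqrt_pos.2 (h.negDet_pos z (hUD hz))
  have hk : ∀ v, 2 * √(negDet A B C z) * dirDeriv v (fun z => √(negDet A B C z)) z =
      dirDeriv v (negDet A B C) z := by
    intro v
    rw [← dirDeriv_congr hU hz
      (f := fun z => √(negDet A B C z) * √(negDet A B C z)) fun y hy =>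
      Real.mul_self_sqrt (h.negDet_pos y (hUD hy)).le, dirDeriv_mul dk dk]
    ring
  -- A quotient q = w/N is differentiated through q·N = w.
  have hquot : ∀ (v : ℝ × ℝ) (w q : ℝ × ℝ → ℝ), DifferentiableAt ℝ w z →
      DifferentiableAt ℝ q z → (∀ y ∈ U, q y * gradNormSq A B C R y = w y) →
      dirDeriv v q z * gradNormSq A B C R z + q z * dirDeriv v (gradNormSq A B C R) z =
        dirDeriv v w z := by
    intro v w q hw hq e
    rw [← dirDeriv_mul hq dN]
    exact dirDeriv_congr hU hz e
  have q0 := hquot (0, 1) _ _ (dk.fun_mul d2) (c0.differentiableAt_of_mem hU hz)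
    fun y hy => div_mul_cancel₀ _ (hN y hy)
  have q1 := hquot (1, 0) _ _ (dk.fun_mul d1).fun_neg (c1.differentiableAt_of_mem hU hz)
    fun y hy => by
      rw [neg_mul, div_mul_cancel₀ _ (hN y hy)]
  have hneg : dirDeriv (1, 0) (fun y => -(√(negDet A B C y) * gradT A B C R y)) z =
      -dirDeriv (1, 0) (fun y => √(negDet A B C y) * gradT A B C R y) z := by
    simp only [dirDeriv]; rw [fderiv_fun_neg]; rfl
  rw [dirDeriv_mul dk d2] at q0
  rw [hneg, dirDeriv_mul dk d1] at q1
  have hR := h.R_pos z (hUD hz)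
  have nt := h.dt_gradNormSq (hUD hz)
  have nr := h.dr_gradNormSq (hUD hz)
  have dv := h.divergence (hUD hz)
  have k0 := hk (0, 1)
  have k1 := hk (1, 0)
  have hkk := Real.sq_sqrt (h.negDet_pos z (hUD hz)).le
  have hNz := hN z hz
  have hNdef : gradNormSq A B C R z = gradT A B C R z * dt R z + gradR A B C R z * dr R z := rfl
  simp only [dt, dr] at *
  set ω0 := dirDeriv (0, 1)
    (fun z => √(negDet A B C z) * gradR A B C R z / gradNormSq A B C R z) z
  set ω1 := dirDeriv (1, 0)
    (fun z => -(√(negDet A B C z) * gradT A B C R z / gradNormSq A B C R z)) z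
  set k := √(negDet A B C z)
  set N := gradNormSq A B C R z
  set u := gradT A B C R z
  set w := gradR A B C R z
  -- Up to the nonzero factor, d(⋆dR/N) is N□R - dN(∇R). With F = 1 - N - ΛR² both terms equal FN/R,
  -- by the trace equation and by R dN = F dR.
  have g0 : (ω0 - ω1) * (2 * k * R z * N ^ 2) = 0 := by
    have q0' : ω0 * N ^ 2 = N * (dirDeriv (0, 1) (fun z => √(negDet A B C z)) z * w
        + k * dirDeriv (0, 1) (gradR A B C R) z)
        - k * w * dirDeriv (0, 1) (gradNormSq A B C R) z := by
      rw [← q0]; field_simp; ring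
    have q1' : ω1 * N ^ 2 = N * -(dirDeriv (1, 0) (fun z => √(negDet A B C z)) z * u
        + k * dirDeriv (1, 0) (gradT A B C R) z)
        + k * u * dirDeriv (1, 0) (gradNormSq A B C R) z := by
      rw [← q1]; field_simp; ring
    linear_combination 2 * k * R z * (q0' - q1') + N * dv + R z * N * (w * k0 + u * k1)
      - 2 * k ^ 2 * (w * nr + u * nt)
      + (2 * R z * N * (dirDeriv (1, 0) (gradT A B C R) z + dirDeriv (0, 1) (gradR A B C R) z)
        - 2 * N * (1 - N - Λ * R z ^ 2)) * hkk
      + 2 * k ^ 2 * (1 - N - Λ * R z ^ 2) * hNdef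
  have hne : (2 * k * R z * N ^ 2) ≠ 0 := by positivity
  exact sub_eq_zero.1 ((mul_eq_zero.1 g0).resolve_right hne)

/-- The metric in terms of `dT` and `dR`. -/
theorem metric_eq {z : ℝ × ℝ} (hz : z ∈ D) (hN : gradNormSq A B C R z ≠ 0) :
    let ω0 := √(negDet A B C z) * gradR A B C R z / gradNormSq A B C R z
    let ω1 := -(√(negDet A B C z) * gradT A B C R z / gradNormSq A B C R z)
    A z = -gradNormSq A B C R z * ω0 * ω0 + (gradNormSq A B C R z)⁻¹ * dt R z * dt R z ∧
    B z = -gradNormSq A B C R z * ω0 * ω1 + (gradNormSq A B C R z)⁻¹ * dt R z * dr R z ∧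
    C z = -gradNormSq A B C R z * ω1 * ω1 + (gradNormSq A B C R z)⁻¹ * dr R z * dr R z ∧
    ω0 * dr R z - ω1 * dt R z = √(negDet A B C z) := by
  have hkk := Real.sq_sqrt (h.negDet_pos z hz).le
  have hNdef : gradNormSq A B C R z = gradT A B C R z * dt R z + gradR A B C R z * dr R z := rfl
  rw [← h.lower_t hz, ← h.lower_r hz] at hNdef ⊢
  have hd : negDet A B C z = B z ^ 2 - A z * C z := rfl
  set k := √(negDet A B C z)
  set N := gradNormSq A B C R z
  set u := gradT A B C R z
  set w := gradR A B C R z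
  rw [hd] at hkk
  intro ω0 ω1
  -- For a covector α in a Lorentzian plane, α ⊗ α - ⋆α ⊗ ⋆α = |α|² h; this is applied to α = dR and
  -- divided by N. The last identity says that dT ∧ dR is the volume form.
  refine ⟨?_, ?_, ?_, ?_⟩ <;> simp only [ω0, ω1]
  · field_simp; rw [hkk]; linear_combination A z * hNdef
  · field_simp; rw [hkk]; linear_combination B z * hNdef
  · field_simp; rw [hkk]; linear_combination C z * hNdef
  · calc _ = k * (u * (A z * u + B z * w) + w * (B z * u + C z * w)) / N := by ring
      _ = k := by rw [← hNdef, mul_div_assoc, div_self hN, mul_one]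

end IsReducedEinstein

/-- A closed smooth form on a convex open subset of the plane has a smooth primitive. -/
theorem exists_primitive {U : Set (ℝ × ℝ)} (hU : IsOpen U) (hc : Convex ℝ U) {ω0 ω1 : ℝ × ℝ → ℝ}
    (h0 : ContDiffOn ℝ ∞ ω0 U) (h1 : ContDiffOn ℝ ∞ ω1 U) (hcl : ∀ z ∈ U, dr ω0 z = dt ω1 z) :
    ∃ T : ℝ × ℝ → ℝ, ContDiffOn ℝ ∞ T U ∧ ∀ z ∈ U, dt T z = ω0 z ∧ dr T z = ω1 z := by
  let α : ℝ × ℝ → (ℝ × ℝ) →L[ℝ] ℝ := fun z =>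
    ω0 z • ContinuousLinearMap.fst ℝ ℝ ℝ + ω1 z • ContinuousLinearMap.snd ℝ ℝ ℝ
  have hα : ContDiffOn ℝ ∞ α U := (h0.smul contDiffOn_const).add (h1.smul contDiffOn_const)
  obtain ⟨T, hT⟩ := hc.exists_forall_hasFDerivAt_of_fderiv_symmetric hU
    (hα.differentiableOn (by simp)) (by
      intro z hz x y
      have d0 := h0.differentiableAt_of_mem hU hz
      have d1 := h1.differentiableAt_of_mem hU hz
      have hd : HasFDerivAt α _ z := (d0.hasFDerivAt.smul_const (ContinuousLinearMap.fst ℝ ℝ ℝ)).add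
        (d1.hasFDerivAt.smul_const (ContinuousLinearMap.snd ℝ ℝ ℝ))
      rw [hd.fderiv]
      have e : ∀ (f : ℝ × ℝ → ℝ) (w : ℝ × ℝ), fderiv ℝ f z w = w.1 * dt f z + w.2 * dr f z := by
        intro f w
        have hw : w = w.1 • ((1, 0) : ℝ × ℝ) + w.2 • ((0, 1) : ℝ × ℝ) := by ext <;> simp
        conv_lhs => rw [hw, map_add, map_smul, map_smul]
        rfl
      simp [e]
      linear_combination (x.2 * y.1 - y.2 * x.1) * hcl z hz)
  refine ⟨T, ?_, fun z hz => ?_⟩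
  · rw [contDiffOn_infty_iff_fderiv_of_isOpen hU]
    exact ⟨fun z hz => (hT z hz).differentiableAt.differentiableWithinAt,
      hα.congr fun z hz => (hT z hz).fderiv⟩
  · simp [dirDeriv, (hT z hz).fderiv, α]

/-! ### The orbit map and the metric away from the axis -/

/-- The time coordinate and the distance from the origin. -/
def orbitMap (x : Coord) : ℝ × ℝ := (x 0, radius x)

/-- The components of the differential of the time coordinate. -/
def timeCovec (i : Fin 4) : ℝ := if i = 0 then 1 else 0

/-- The components of `d|x|`. -/
def radialCovec (x : Coord) (i : Fin 4) : ℝ := if i = 0 then 0 else x i / radius x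

theorem radius_sq (x : Coord) : radius x ^ 2 = x 1 ^ 2 + x 2 ^ 2 + x 3 ^ 2 :=
  Real.sq_sqrt (by positivity)

theorem orbitMap_rot {A : Matrix (Fin 3) (Fin 3) ℝ}
    (hA : A ∈ Matrix.specialOrthogonalGroup (Fin 3) ℝ) (x : Coord) :
    orbitMap (rotMatrix A *ᵥ x) = orbitMap x := by
  have h0 : (rotMatrix A *ᵥ x) 0 = x 0 := by
    simp [rotMatrix, Matrix.mulVec, dotProduct, Fin.sum_univ_succ]
  have hO := (Matrix.mem_orthogonalGroup_iff' (Fin 3) ℝ).1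
    (Matrix.mem_specialOrthogonalGroup_iff.1 hA).1
  have e := fun i j => congrFun (congrFun hO i) j
  simp only [Matrix.mul_apply, Fin.sum_univ_three] at e
  have e00 := e 0 0
  have e01 := e 0 1
  have e02 := e 0 2
  have e11 := e 1 1
  have e12 := e 1 2
  have e22 := e 2 2
  simp at e00 e01 e02 e11 e12 e22
  have hr : radius (rotMatrix A *ᵥ x) = radius x := by
    unfold radius
    congr 1
    simp [rotMatrix, Matrix.mulVec, dotProduct, Fin.sum_univ_succ]
    linear_combination x 1 ^ 2 * e00 + 2 * x 1 * x 2 * e01 + 2 * x 1 * x 3 * e02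
      + x 2 ^ 2 * e11 + 2 * x 2 * x 3 * e12 + x 3 ^ 2 * e22
  simp [orbitMap, h0, hr]

theorem exists_polar_angles {x : Coord} (hx : 0 < radius x) : ∃ c d n s : ℝ,
    c ^ 2 + d ^ 2 = 1 ∧ n ^ 2 + s ^ 2 = 1 ∧
    x 1 = n * radius x ∧ x 2 = c * s * radius x ∧ x 3 = d * s * radius x := by
  have hr := radius_sq x
  by_cases h : x 2 ^ 2 + x 3 ^ 2 = 0
  · have h2 : x 2 = 0 := by nlinarith [sq_nonneg (x 2), sq_nonneg (x 3)]
    have h3 : x 3 = 0 := by nlinarith [sq_nonneg (x 2), sq_nonneg (x 3)]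
    -- On the first axis the longitude is undefined and (1, 0) is chosen; n is then 1 or -1, which
    -- covers both half-axes.
    refine ⟨1, 0, x 1 / radius x, 0, by norm_num, ?_, ?_, by simp [h2], by simp [h3]⟩
    · field_simp; rw [hr, h2, h3]; ring
    · field_simp
  · have hpos : 0 < x 2 ^ 2 + x 3 ^ 2 := lt_of_le_of_ne (by positivity) (Ne.symm h)
    have hs := Real.sqrt_pos.2 hpos
    have hss := Real.sq_sqrt hpos.le
    refine ⟨x 2 / √(x 2 ^ 2 + x 3 ^ 2), x 3 / √(x 2 ^ 2 + x 3 ^ 2), x 1 / radius x,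
      √(x 2 ^ 2 + x 3 ^ 2) / radius x, ?_, ?_, ?_, ?_, ?_⟩
    · field_simp; rw [hss]
    · field_simp; rw [hss, hr]; ring
    all_goals field_simp

theorem exists_rot_axisPt {x : Coord} (hx : 0 < radius x) : ∃ c d n s : ℝ,
    c ^ 2 + d ^ 2 = 1 ∧ n ^ 2 + s ^ 2 = 1 ∧
    x 1 = n * radius x ∧ x 2 = c * s * radius x ∧ x 3 = d * s * radius x ∧
    rotMatrix (planeRot 2 c d * planeRot 0 n s) *ᵥ axisPt (orbitMap x) = x ∧
    rotMatrix (planeRot 0 n (-s) * planeRot 2 c (-d)) *ᵥ x = axisPt (orbitMap x) := by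
  obtain ⟨c, d, n, s, h1, h2, e1, e2, e3⟩ := exists_polar_angles hx
  refine ⟨c, d, n, s, h1, h2, e1, e2, e3, ?_, ?_⟩
  · simp only [rotMatrix_mul, ← Matrix.mulVec_mulVec]
    ext i
    fin_cases i <;>
      simp [rotMatrix, planeRot, Matrix.mulVec, dotProduct, Fin.sum_univ_succ, axisPt, orbitMap,
        e1, e2, e3] <;> ring
  · have hr := radius_sq x
    simp only [rotMatrix_mul, ← Matrix.mulVec_mulVec, orbitMap]
    generalize radius x = r at *
    ext i
    fin_cases i <;>
      simp [rotMatrix, planeRot, Matrix.mulVec, dotProduct, Fin.sum_univ_succ, axisPt, e1, e2, e3]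
    all_goals grind

theorem radius_axisPt {z : ℝ × ℝ} (hz : 0 < z.2) : radius (axisPt z) = z.2 := by
  simp [radius, axisPt, Real.sqrt_sq hz.le]

theorem orbitMap_axisPt {z : ℝ × ℝ} (hz : 0 < z.2) : orbitMap (axisPt z) = z :=
  Prod.ext rfl (radius_axisPt hz)

/-- The points of the half plane that represent the rotation orbits in `Ω`. -/
def orbitSpace (Ω : Set Coord) : Set (ℝ × ℝ) := {z | axisPt z ∈ Ω ∧ 0 < z.2}

/-- The areal radius as a function of the orbit. -/
def orbitRadius (g : MetricField) (z : ℝ × ℝ) : ℝ := z.2 * √(g (axisPt z) 2 2)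

theorem contDiff_axisPt : ContDiff ℝ ∞ axisPt := by
  rw [contDiff_pi]
  intro i
  fin_cases i <;> simp [axisPt] <;> fun_prop

theorem continuous_radius : Continuous radius := by
  unfold radius; fun_prop

theorem continuous_orbitMap : Continuous orbitMap :=
  (continuous_apply 0).prodMk continuous_radius

theorem contDiffOn_radius {Ω : Set Coord} (hΩ : ∀ x ∈ Ω, 0 < radius x) :
    ContDiffOn ℝ ∞ radius Ω := by
  unfold radius
  refine ContDiffOn.sqrt (by fun_prop) fun x hx => ?_
  rw [← radius_sq]
  exact (pow_pos (hΩ x hx) 2).ne'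

theorem contDiffOn_orbitMap {Ω : Set Coord} (hΩ : ∀ x ∈ Ω, 0 < radius x) :
    ContDiffOn ℝ ∞ orbitMap Ω :=
  (contDiff_apply ℝ ℝ (0 : Fin 4)).contDiffOn.prodMk (contDiffOn_radius hΩ)

theorem isOpen_radius_pos : IsOpen {x : Coord | 0 < radius x} :=
  isOpen_lt continuous_const continuous_radius

theorem pd_radius {x : Coord} (hx : 0 < radius x) (i : Fin 4) : pd i radius x = radialCovec x i := by
  have dR : DifferentiableAt ℝ radius x :=
    (contDiffOn_radius fun _ h => h).differentiableAt_of_mem isOpen_radius_pos hx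
  have e : (fun y => radius y * radius y) = fun y => y 1 * y 1 + y 2 * y 2 + y 3 * y 3 := by
    funext y; have := radius_sq y; linarith
  have e2 : pd i (fun y => radius y * radius y) x = _ := congrArg (fun u => pd i u x) e
  have dy : ∀ j, DifferentiableAt ℝ (fun y : Coord => y j) x := fun j => by fun_prop
  have dyy : ∀ j, DifferentiableAt ℝ (fun y : Coord => y j * y j) x := fun j => by fun_prop
  rw [pd_mul dR dR, pd_add ((dyy 1).fun_add (dyy 2)) (dyy 3), pd_add (dyy 1) (dyy 2),
    pd_mul (dy 1) (dy 1), pd_mul (dy 2) (dy 2), pd_mul (dy 3) (dy 3)] at e2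
  simp only [pd_coord] at e2
  have hs : ((if i = 1 then 1 else 0) * x 1 + x 1 * (if i = 1 then 1 else 0) +
      ((if i = 2 then 1 else 0) * x 2 + x 2 * (if i = 2 then 1 else 0)) +
      ((if i = 3 then 1 else 0) * x 3 + x 3 * (if i = 3 then 1 else 0)) : ℝ) =
      2 * (radius x * radialCovec x i) := by
    rw [radialCovec]
    fin_cases i <;> simp <;> field_simp <;> ring
  have hm : radius x * pd i radius x = radius x * radialCovec x i := by
    linarith
  exact mul_left_cancel₀ hx.ne' hm

theorem pd_comp_orbitMap {u : ℝ × ℝ → ℝ} {x : Coord} (hx : 0 < radius x)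
    (hu : DifferentiableAt ℝ u (orbitMap x)) (i : Fin 4) :
    pd i (fun y => u (orbitMap y)) x =
      dt u (orbitMap x) * timeCovec i + dr u (orbitMap x) * radialCovec x i := by
  have dR : DifferentiableAt ℝ radius x :=
    (contDiffOn_radius fun _ h => h).differentiableAt_of_mem isOpen_radius_pos hx
  have d0 : DifferentiableAt ℝ (fun y : Coord => y 0) x := by fun_prop
  have hd : HasFDerivAt orbitMap _ x := d0.hasFDerivAt.prodMk dR.hasFDerivAt
  have hc := hu.hasFDerivAt.comp x hd
  have e : ∀ w : ℝ × ℝ, fderiv ℝ u (orbitMap x) w =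
      dt u (orbitMap x) * w.1 + dr u (orbitMap x) * w.2 := by
    intro w
    have hw : w = w.1 • ((1, 0) : ℝ × ℝ) + w.2 • ((0, 1) : ℝ × ℝ) := by ext <;> simp
    conv_lhs => rw [hw, map_add, map_smul, map_smul]
    simp only [dt, dr, dirDeriv, smul_eq_mul]; ring
  have hp := pd_radius hx i
  have h0 : pd i (fun y : Coord => y 0) x = timeCovec i := by rw [pd_coord]; rfl
  rw [← hp, ← h0]
  change fderiv ℝ (u ∘ orbitMap) x _ = _
  rw [hc.fderiv, ContinuousLinearMap.comp_apply, e]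
  rfl

theorem dirDeriv_comp_axisPt {u : Coord → ℝ} {z : ℝ × ℝ} (hu : DifferentiableAt ℝ u (axisPt z)) :
    dt (fun w => u (axisPt w)) z = pd 0 u (axisPt z) ∧
      dr (fun w => u (axisPt w)) z = pd 1 u (axisPt z) := by
  have hlin : HasFDerivAt axisPt (ContinuousLinearMap.pi
      ![ContinuousLinearMap.fst ℝ ℝ ℝ, ContinuousLinearMap.snd ℝ ℝ ℝ, 0, 0] :
      ℝ × ℝ →L[ℝ] Coord) z := by
    rw [hasFDerivAt_pi]
    intro i
    fin_cases i
    · exact hasFDerivAt_fst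
    · exact hasFDerivAt_snd
    · exact hasFDerivAt_const _ _
    · exact hasFDerivAt_const _ _
  have hc := hu.hasFDerivAt.comp z hlin
  constructor
  · change fderiv ℝ (u ∘ axisPt) z _ = fderiv ℝ u _ _
    rw [hc.fderiv, ContinuousLinearMap.comp_apply]
    congr 1
    ext i; fin_cases i <;> simp
  · change fderiv ℝ (u ∘ axisPt) z _ = fderiv ℝ u _ _
    rw [hc.fderiv, ContinuousLinearMap.comp_apply]
    congr 1
    ext i; fin_cases i <;> simp

namespace IsSphericallySymmetricSpacetime

variable {Ω : Set Coord} {g : MetricField} (hg : IsSphericallySymmetricSpacetime Ω g)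
include hg

theorem axisPt_orbitMap_mem {x : Coord} (hx : x ∈ Ω) : axisPt (orbitMap x) ∈ Ω := by
  obtain ⟨c, d, n, s, h1, h2, -, -, -, -, h⟩ := exists_rot_axisPt (hg.radius_pos x hx)
  rw [← h]
  refine hg.rot_mem _ (mul_mem (planeRot_mem 0 ?_) (planeRot_mem 2 ?_)) x hx <;> simpa

theorem orbitMap_mem {x : Coord} (hx : x ∈ Ω) : orbitMap x ∈ orbitSpace Ω :=
  ⟨hg.axisPt_orbitMap_mem hx, hg.radius_pos x hx⟩

theorem orbitSpace_eq_image : orbitSpace Ω = orbitMap '' Ω := by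
  ext z
  constructor
  · rintro ⟨h1, h2⟩
    exact ⟨_, h1, orbitMap_axisPt h2⟩
  · rintro ⟨x, hx, rfl⟩
    exact hg.orbitMap_mem hx

theorem isOpen_orbitSpace : IsOpen (orbitSpace Ω) :=
  (hg.isOpen.preimage contDiff_axisPt.continuous).inter (isOpen_lt continuous_const continuous_snd)

theorem isPreconnected_orbitSpace : IsPreconnected (orbitSpace Ω) := by
  rw [hg.orbitSpace_eq_image]
  exact hg.isConnected.isPreconnected.image _ continuous_orbitMap.continuousOn

/-- A rotation P carries the axis point to `x`, so g(x) = P g Pᵀ with g of axial form. Column 1 of P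
is the direction n = x/|x|, and columns 2 and 3 span its orthogonal complement, so the scalar block
becomes a multiple of δ - n ⊗ n, that is, of the round metric. -/
theorem metric_apply {x : Coord} (hx : x ∈ Ω) (i j : Fin 4) :
    g x i j = g (axisPt (orbitMap x)) 0 0 * timeCovec i * timeCovec j
      + g (axisPt (orbitMap x)) 0 1
        * (timeCovec i * radialCovec x j + radialCovec x i * timeCovec j)
      + g (axisPt (orbitMap x)) 1 1 * radialCovec x i * radialCovec x j
      + radius x ^ 2 * g (axisPt (orbitMap x)) 2 2 * roundMetric x i j := by
  have hr := hg.radius_pos x hx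
  obtain ⟨c, d, n, s, h1, h2, e1, e2, e3, hrot, -⟩ := exists_rot_axisPt hr
  have hy := hg.axisPt_orbitMap_mem hx
  have hmem : planeRot 2 c d * planeRot 0 n s ∈ Matrix.specialOrthogonalGroup (Fin 3) ℝ :=
    mul_mem (planeRot_mem 2 h1) (planeRot_mem 0 h2)
  have hiso := hg.isometry _ hmem _ hy
  rw [hrot, hg.metric_axis hy] at hiso
  have hO : rotMatrix (planeRot 2 c d * planeRot 0 n s)
      * (rotMatrix (planeRot 2 c d * planeRot 0 n s))ᵀ = 1 := by
    rw [← rotMatrix_transpose, ← rotMatrix_mul, ← rotMatrix_one]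
    congr 1
    exact (Matrix.mem_orthogonalGroup_iff (Fin 3) ℝ).1
      (Matrix.mem_specialOrthogonalGroup_iff.1 hmem).1
  set P := rotMatrix (planeRot 2 c d * planeRot 0 n s) with hP
  have hgx : g x = P * axialMat (g (axisPt (orbitMap x)) 0 0) (g (axisPt (orbitMap x)) 0 1)
      (g (axisPt (orbitMap x)) 1 1) (g (axisPt (orbitMap x)) 2 2) * Pᵀ := by
    rw [← hiso]
    calc g x = (P * Pᵀ) * g x * (P * Pᵀ) := by rw [hO]; simp
      _ = _ := by simp only [Matrix.mul_assoc]
  have hPe : P = !![1, 0, 0, 0; 0, n, -s, 0; 0, c * s, c * n, -d; 0, d * s, d * n, c] := by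
    rw [hP, rotMatrix_mul]
    ext i j
    fin_cases i <;> fin_cases j <;>
      simp [rotMatrix, planeRot, Matrix.mul_apply, Fin.sum_univ_succ]
  rw [hgx, hPe]
  have v1 : x 1 / radius x = n := by rw [e1]; field_simp
  have v2 : x 2 / radius x = c * s := by rw [e2]; field_simp
  have v3 : x 3 / radius x = d * s := by rw [e3]; field_simp
  have hround : ∀ i j : Fin 4, i ≠ 0 → j ≠ 0 → radius x ^ 2 * g (axisPt (orbitMap x)) 2 2
      * roundMetric x i j = g (axisPt (orbitMap x)) 2 2
        * ((if i = j then 1 else 0) - (x i / radius x) * (x j / radius x)) := by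
    intro i j hi hj
    simp only [roundMetric, hi, hj, or_self, if_false]
    field_simp
  generalize g (axisPt (orbitMap x)) = G at *
  fin_cases i <;> fin_cases j
  all_goals first
    | (rw [hround _ _ (by decide) (by decide)]
       simp [axialMat, timeCovec, radialCovec, Matrix.mul_apply, Fin.sum_univ_four, v1, v2, v3]
       grind)
    | (simp [axialMat, timeCovec, radialCovec, Matrix.mul_apply, Fin.sum_univ_four, v1, v2, v3,
        roundMetric]
       try grind)

end IsSphericallySymmetricSpacetime

/-! ### Signature, Einstein equations and transverse jets on the axis -/

theorem IsLorentzian.axialMat_signature {A B C a : ℝ} (h : IsLorentzian (axialMat A B C a)) :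
    A * C < B ^ 2 ∧ 0 < a := by
  obtain ⟨-, P, hP, h⟩ := h
  have hdet := congrArg Matrix.det h
  have hdG : (axialMat A B C a).det = (A * C - B ^ 2) * a ^ 2 := by
    simp [axialMat, Matrix.det_succ_row_zero, Fin.sum_univ_succ, Fin.succAbove]
    ring
  have hdd : (Matrix.diagonal ![-1, 1, 1, 1] : Matrix (Fin 4) (Fin 4) ℝ).det = -1 := by
    simp [Fin.prod_univ_succ]
  rw [Matrix.det_mul, Matrix.det_mul, Matrix.det_transpose, hdd, hdG] at hdet
  have hneg : (A * C - B ^ 2) * a ^ 2 < 0 := by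
    by_contra hc
    nlinarith [mul_nonneg (not_lt.1 hc) (sq_nonneg P.det)]
  have ha : a ≠ 0 := by rintro rfl; simp at hneg
  have ha2 : 0 < a ^ 2 := by positivity
  refine ⟨by nlinarith, lt_of_le_of_ne ?_ (Ne.symm ha)⟩
  have hG : axialMat A B C a = (P⁻¹)ᵀ * Matrix.diagonal ![-1, 1, 1, 1] * P⁻¹ := by
    have h1 : P * P⁻¹ = 1 := Matrix.mul_nonsing_inv _ hP
    have h2 : (P⁻¹)ᵀ * Pᵀ = 1 := by rw [← Matrix.transpose_mul, h1, Matrix.transpose_one]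
    rw [← h]
    calc axialMat A B C a = ((P⁻¹)ᵀ * Pᵀ) * axialMat A B C a * (P * P⁻¹) := by rw [h1, h2]; simp
      _ = _ := by simp only [Matrix.mul_assoc]
  generalize P⁻¹ = Q at hG
  have e := fun i j => congrFun (congrFun hG i) j
  have e22 := e 2 2
  have e23 := e 2 3
  have e33 := e 3 3
  simp [axialMat, Matrix.mul_apply, Fin.sum_univ_four, Matrix.diagonal_apply] at e22 e23 e33
  -- Evaluate the form on the vector of the 23-plane with entries Q₀₃ and -Q₀₂: its image under Q
  -- has no timelike component, so the value is a sum of squares. Hence a < 0 would force Q₀₂ = 0,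
  -- and then the entry (2,2) is itself a sum of squares.
  have key : a * (Q 0 2 ^ 2 + Q 0 3 ^ 2) = (Q 0 3 * Q 1 2 - Q 0 2 * Q 1 3) ^ 2
      + (Q 0 3 * Q 2 2 - Q 0 2 * Q 2 3) ^ 2 + (Q 0 3 * Q 3 2 - Q 0 2 * Q 3 3) ^ 2 := by
    linear_combination Q 0 3 ^ 2 * e22 - 2 * Q 0 2 * Q 0 3 * e23 + Q 0 2 ^ 2 * e33
  by_contra hlt
  have hz : Q 0 2 = 0 := by
    have : Q 0 2 ^ 2 ≤ 0 := by
      by_contra hq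
      have hpos : 0 < Q 0 2 ^ 2 + Q 0 3 ^ 2 := by nlinarith [sq_nonneg (Q 0 3)]
      have := mul_neg_of_neg_of_pos (not_le.1 hlt) hpos
      rw [key] at this
      have h3 : 0 ≤ (Q 0 3 * Q 1 2 - Q 0 2 * Q 1 3) ^ 2
        + (Q 0 3 * Q 2 2 - Q 0 2 * Q 2 3) ^ 2 + (Q 0 3 * Q 3 2 - Q 0 2 * Q 3 3) ^ 2 := by
        positivity
      linarith
    exact pow_eq_zero_iff two_ne_zero |>.1 (le_antisymm this (sq_nonneg _))
  rw [hz] at e22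
  nlinarith [sq_nonneg (Q 1 2), sq_nonneg (Q 2 2), sq_nonneg (Q 3 2)]

theorem inv_axialMat {A B C a : ℝ} (hd : B ^ 2 - A * C ≠ 0) (ha : a ≠ 0) :
    (axialMat A B C a)⁻¹ = axialMat (-C / (B ^ 2 - A * C)) (B / (B ^ 2 - A * C))
      (-A / (B ^ 2 - A * C)) a⁻¹ := by
  refine Matrix.inv_eq_right_inv ?_
  ext i j
  fin_cases i <;> fin_cases j <;>
    simp [axialMat, Matrix.mul_apply, Fin.sum_univ_four, ha] <;> field_simp <;> ring

/-- The Einstein equations at a point of the axis, solved for the Hessian of the areal radius. -/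
theorem hess_eq_of_einstein {A B C a p q s ρ x00 x01 x11 K N Λ δ : ℝ} (hδ : δ = B ^ 2 - A * C)
    (hd : δ ≠ 0) (ha : a ≠ 0) (hp : p = -C / δ) (hq : q = B / δ) (hs : s = -A / δ)
    (E0 : s * K - x00 = Λ * A) (E1 : -q * K - x01 = Λ * B) (E2 : p * K - x11 = Λ * C)
    (E3 : ρ ^ 2 - a * (N + (p * x00 + 2 * q * x01 + s * x11) / 2) = Λ * a) :
    x00 = (a⁻¹ * ρ ^ 2 - N - Λ) * A ∧ x01 = (a⁻¹ * ρ ^ 2 - N - Λ) * B ∧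
      x11 = (a⁻¹ * ρ ^ 2 - N - Λ) * C := by
  -- Since (s, -q, p) = -(A, B, C)/δ, the curvature term is a multiple of h, so the Hessian term is
  -- too.
  have h0 : x00 = (-K / δ - Λ) * A := by rw [hs] at E0; linear_combination -E0
  have h1 : x01 = (-K / δ - Λ) * B := by rw [hq] at E1; linear_combination -E1
  have h2 : x11 = (-K / δ - Λ) * C := by rw [hp] at E2; linear_combination -E2
  have htr : p * x00 + 2 * q * x01 + s * x11 = 2 * (-K / δ - Λ) := by
    rw [h0, h1, h2, hp, hq, hs]
    have : -C / δ * ((-K / δ - Λ) * A) + 2 * (B / δ) * ((-K / δ - Λ) * B)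
        + -A / δ * ((-K / δ - Λ) * C) = 2 * (-K / δ - Λ) * ((B ^ 2 - A * C) / δ) := by ring
    rw [this, ← hδ, div_self hd, mul_one]
  -- The trace of h is 2, so the angular equation `E3` determines the factor and eliminates the
  -- curvature `K`.
  have hμ : -K / δ - Λ = a⁻¹ * ρ ^ 2 - N - Λ := by
    rw [htr] at E3
    field_simp at E3 ⊢
    linear_combination -E3
  rw [← hμ]
  exact ⟨h0, h1, h2⟩

theorem commute_rotGen_zero (A B C a : ℝ) :
    rotGen 0 * axialMat A B C a - axialMat A B C a * rotGen 0 = offMat2 B (C - a) := by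
  ext i j
  rw [Matrix.sub_apply, Matrix.mul_apply, Matrix.mul_apply, Fin.sum_univ_four, Fin.sum_univ_four]
  fin_cases i <;> fin_cases j <;> simp [rotGen, axialMat, offMat2] <;> ring

theorem commute_rotGen_one (A B C a : ℝ) :
    rotGen 1 * axialMat A B C a - axialMat A B C a * rotGen 1 = offMat3 B (C - a) := by
  ext i j
  rw [Matrix.sub_apply, Matrix.mul_apply, Matrix.mul_apply, Fin.sum_univ_four, Fin.sum_univ_four]
  fin_cases i <;> fin_cases j <;> simp [rotGen, axialMat, offMat3] <;> ring

theorem commute_rotGen_zero_off (b c : ℝ) :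
    rotGen 0 * offMat2 b c - offMat2 b c * rotGen 0 =
        !![0, -b, 0, 0; -b, -2 * c, 0, 0; 0, 0, 2 * c, 0; 0, 0, 0, 0] ∧
      rotGen 0 * offMat3 b c - offMat3 b c * rotGen 0 =
        !![0, 0, 0, 0; 0, 0, 0, 0; 0, 0, 0, c; 0, 0, c, 0] := by
  constructor <;> ext i j <;>
  rw [Matrix.sub_apply, Matrix.mul_apply, Matrix.mul_apply, Fin.sum_univ_four, Fin.sum_univ_four] <;>
  fin_cases i <;> fin_cases j <;> simp [rotGen, offMat2, offMat3] <;> ring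

theorem commute_rotGen_one_off (b c : ℝ) :
    rotGen 1 * offMat2 b c - offMat2 b c * rotGen 1 =
        !![0, 0, 0, 0; 0, 0, 0, 0; 0, 0, 0, c; 0, 0, c, 0] ∧
      rotGen 1 * offMat3 b c - offMat3 b c * rotGen 1 =
        !![0, -b, 0, 0; -b, -2 * c, 0, 0; 0, 0, 0, 0; 0, 0, 0, 2 * c] := by
  constructor <;> ext i j <;>
  rw [Matrix.sub_apply, Matrix.mul_apply, Matrix.mul_apply, Fin.sum_univ_four, Fin.sum_univ_four] <;>
  fin_cases i <;> fin_cases j <;> simp [rotGen, offMat2, offMat3] <;> ring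

theorem smul_offMat2 (ρ b c : ℝ) : ρ • offMat2 b c = offMat2 (b * ρ) (c * ρ) := by
  ext i j; fin_cases i <;> fin_cases j <;> simp [offMat2, mul_comm]

theorem smul_offMat3 (ρ b c : ℝ) : ρ • offMat3 b c = offMat3 (b * ρ) (c * ρ) := by
  ext i j; fin_cases i <;> fin_cases j <;> simp [offMat3, mul_comm]

theorem offMat2_sub (b c b' c' : ℝ) : offMat2 b c - offMat2 b' c' = offMat2 (b - b') (c - c') := by
  ext i j; fin_cases i <;> fin_cases j <;> simp [offMat2]

theorem offMat3_sub (b c b' c' : ℝ) : offMat3 b c - offMat3 b' c' = offMat3 (b - b') (c - c') := by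
  ext i j; fin_cases i <;> fin_cases j <;> simp [offMat3]

theorem sum_rotGen_zero (D : Fin 4 → Matrix (Fin 4) (Fin 4) ℝ) (n : Fin 4) :
    ∑ k, rotGen 0 k n • D k = (![0, D 2, -D 1, 0] : Fin 4 → Matrix (Fin 4) (Fin 4) ℝ) n := by
  rw [Fin.sum_univ_four]
  fin_cases n <;> simp [rotGen]

theorem sum_rotGen_one (D : Fin 4 → Matrix (Fin 4) (Fin 4) ℝ) (n : Fin 4) :
    ∑ k, rotGen 1 k n • D k = (![0, D 3, 0, -D 1] : Fin 4 → Matrix (Fin 4) (Fin 4) ℝ) n := by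
  rw [Fin.sum_univ_four]
  fin_cases n <;> simp [rotGen]

theorem axialData_of_killing {A B C a A0 B0 C0 a0 A1 B1 C1 a1 ρ : ℝ}
    {A00 B00 C00 a00 A01 B01 C01 a01 A11 B11 C11 a11 : ℝ} {G : Matrix (Fin 4) (Fin 4) ℝ}
    {D : Fin 4 → Matrix (Fin 4) (Fin 4) ℝ} {H : Fin 4 → Fin 4 → Matrix (Fin 4) (Fin 4) ℝ}
    (hG : G = axialMat A B C a) (D0 : D 0 = axialMat A0 B0 C0 a0) (D1 : D 1 = axialMat A1 B1 C1 a1)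
    (H00 : H 0 0 = axialMat A00 B00 C00 a00) (H01 : H 0 1 = axialMat A01 B01 C01 a01)
    (H11 : H 1 1 = axialMat A11 B11 C11 a11) (symm : ∀ m k, H m k = H k m)
    (D2 : D 2 = ρ • (rotGen 0 * G - G * rotGen 0)) (D3 : D 3 = ρ • (rotGen 1 * G - G * rotGen 1))
    (K2 : ∀ n, H n 2 = ρ • (rotGen 0 * D n - D n * rotGen 0 - ∑ k, rotGen 0 k n • D k))
    (K3 : ∀ n, H n 3 = ρ • (rotGen 1 * D n - D n * rotGen 1 - ∑ k, rotGen 1 k n • D k)) :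
    AxialData A B C a A0 B0 C0 a0 A1 B1 C1 a1 ρ
      A00 B00 C00 a00 A01 B01 C01 a01 A11 B11 C11 a11 D H := by
  rw [hG, commute_rotGen_zero, smul_offMat2] at D2
  rw [hG, commute_rotGen_one, smul_offMat3] at D3
  simp only [sum_rotGen_zero] at K2
  simp only [sum_rotGen_one] at K3
  have H02 : H 0 2 = offMat2 (B0 * ρ) ((C0 - a0) * ρ) := by
    rw [K2, D0, commute_rotGen_zero]; simp [smul_offMat2]
  have H03 : H 0 3 = offMat3 (B0 * ρ) ((C0 - a0) * ρ) := by
    rw [K3, D0, commute_rotGen_one]; simp [smul_offMat3]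
  have H12 : H 1 2 = offMat2 (B1 * ρ - B * ρ ^ 2) ((C1 - a1) * ρ - (C - a) * ρ ^ 2) := by
    rw [K2, D1, commute_rotGen_zero]; simp [smul_offMat2, offMat2_sub, D2]; ring_nf
  have H13 : H 1 3 = offMat3 (B1 * ρ - B * ρ ^ 2) ((C1 - a1) * ρ - (C - a) * ρ ^ 2) := by
    rw [K3, D1, commute_rotGen_one]; simp [smul_offMat3, offMat3_sub, D3]; ring_nf
  have H32 : H 3 2 =
      !![0, 0, 0, 0; 0, 0, 0, 0; 0, 0, 0, (C - a) * ρ ^ 2; 0, 0, (C - a) * ρ ^ 2, 0] := by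
    rw [K2, D3, (commute_rotGen_zero_off _ _).2]
    simp [Matrix.smul_of]; ring_nf
  refine ⟨D0, D1, D2, D3, H00, H01, (symm 1 0).trans H01, H11, H02, (symm 2 0).trans H02, H03,
    (symm 3 0).trans H03, H12, (symm 2 1).trans H12, H13, (symm 3 1).trans H13, ?_, ?_,
    (symm 2 3).trans H32, H32⟩
  · rw [K2, D2, (commute_rotGen_zero_off _ _).1]
    ext i j
    fin_cases i <;> fin_cases j <;> simp [D1, axialMat] <;> ring
  · rw [K3, D3, (commute_rotGen_one_off _ _).2]
    ext i j
    fin_cases i <;> fin_cases j <;> simp [D1, axialMat] <;> ring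

namespace IsSphericallySymmetricSpacetime

variable {Ω : Set Coord} {g : MetricField} (hg : IsSphericallySymmetricSpacetime Ω g)
include hg

theorem signature_axis {z : ℝ × ℝ} (hz : axisPt z ∈ Ω) :
    g (axisPt z) 0 0 * g (axisPt z) 1 1 < g (axisPt z) 0 1 ^ 2 ∧ 0 < g (axisPt z) 2 2 := by
  have h := hg.lorentzian _ hz
  rw [hg.metric_axis hz] at h
  exact h.axialMat_signature

/-- The first and second derivatives of the metric at a point of the axis. -/
theorem axialData {z : ℝ × ℝ} (hz : axisPt z ∈ Ω) :
    let x := axisPt z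
    AxialData (g x 0 0) (g x 0 1) (g x 1 1) (g x 2 2)
      (pdMat 0 g x 0 0) (pdMat 0 g x 0 1) (pdMat 0 g x 1 1) (pdMat 0 g x 2 2)
      (pdMat 1 g x 0 0) (pdMat 1 g x 0 1) (pdMat 1 g x 1 1) (pdMat 1 g x 2 2) z.2⁻¹
      (pdMat 0 (pdMat 0 g) x 0 0) (pdMat 0 (pdMat 0 g) x 0 1) (pdMat 0 (pdMat 0 g) x 1 1)
      (pdMat 0 (pdMat 0 g) x 2 2)
      (pdMat 0 (pdMat 1 g) x 0 0) (pdMat 0 (pdMat 1 g) x 0 1) (pdMat 0 (pdMat 1 g) x 1 1)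
      (pdMat 0 (pdMat 1 g) x 2 2)
      (pdMat 1 (pdMat 1 g) x 0 0) (pdMat 1 (pdMat 1 g) x 0 1) (pdMat 1 (pdMat 1 g) x 1 1)
      (pdMat 1 (pdMat 1 g) x 2 2)
      (fun k => pdMat k g x) (fun m k => pdMat m (pdMat k g) x) := by
  intro x
  have m := hg.metric_axis hz
  have D0 := hg.pdMat_axis hz 0 (by simp)
  have D1 := hg.pdMat_axis hz 1 (by simp)
  have H00 := hg.pdMat_pdMat_axis hz 0 0 (by simp) (by simp)
  have H01 := hg.pdMat_pdMat_axis hz 0 1 (by simp) (by simp)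
  have H11 := hg.pdMat_pdMat_axis hz 1 1 (by simp) (by simp)
  have D2 := hg.pdMat_two_axis hz
  have D3 := hg.pdMat_three_axis hz
  have K2 := hg.pdMat_pdMat_two_axis hz
  have K3 := hg.pdMat_pdMat_three_axis hz
  change pdMat 2 g x = z.2⁻¹ • (rotGen 0 * g x - g x * rotGen 0) at D2
  change pdMat 3 g x = z.2⁻¹ • (rotGen 1 * g x - g x * rotGen 1) at D3
  change ∀ n, pdMat n (pdMat 2 g) x = z.2⁻¹ • (rotGen 0 * pdMat n g x - pdMat n g x * rotGen 0
      - ∑ k, rotGen 0 k n • pdMat k g x) at K2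
  change ∀ n, pdMat n (pdMat 3 g) x = z.2⁻¹ • (rotGen 1 * pdMat n g x - pdMat n g x * rotGen 1
      - ∑ k, rotGen 1 k n • pdMat k g x) at K3
  have c := hg.pdMat_comm hz
  change ∀ m k, pdMat m (pdMat k g) x = pdMat k (pdMat m g) x at c
  have c := hg.pdMat_comm hz
  change ∀ m k, pdMat m (pdMat k g) x = pdMat k (pdMat m g) x at c
  change pdMat 0 g x = axialMat (pdMat 0 g x 0 0) (pdMat 0 g x 0 1) (pdMat 0 g x 1 1)
    (pdMat 0 g x 2 2) at D0
  change pdMat 1 g x = axialMat (pdMat 1 g x 0 0) (pdMat 1 g x 0 1) (pdMat 1 g x 1 1)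
    (pdMat 1 g x 2 2) at D1
  change g x = axialMat (g x 0 0) (g x 0 1) (g x 1 1) (g x 2 2) at m
  exact axialData_of_killing (D := fun k => pdMat k g x) (H := fun m k => pdMat m (pdMat k g) x)
    m D0 D1 H00 H01 H11 c D2 D3 K2 K3

end IsSphericallySymmetricSpacetime

/-! ### The Einstein equations on the orbit space -/

theorem dirDeriv_snd {v z : ℝ × ℝ} : dirDeriv v (fun y => y.2) z = v.2 := by
  simp [dirDeriv, fderiv_snd]

/-- The derivatives of `a = R² / r²` in terms of those of `R`. -/
theorem areal_identities {a r R a0 a1 a00 a01 a11 Rt Rr Rtt Rtr Rrr : ℝ} (hr : 0 < r) (hR : 0 < R)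
    (s0 : R * R = r * (r * a)) (s1 : 2 * (R * Rt) = r * (r * a0))
    (s2 : 2 * (R * Rr) = 2 * (r * a) + r * (r * a1))
    (s3 : 2 * (Rt * Rt + R * Rtt) = r ^ 2 * a00)
    (s4 : 2 * (Rr * Rt + R * Rtr) = 2 * r * a0 + r ^ 2 * a01)
    (s5 : 2 * (Rr * Rr + R * Rrr) = 2 * a + 2 * r * a1 + 2 * r * a1 + r ^ 2 * a11) :
    a0 * a⁻¹ = 2 * Rt / R ∧ a1 * a⁻¹ + 2 * r⁻¹ = 2 * Rr / R ∧
    a00 * a⁻¹ = 2 * (Rt ^ 2 + R * Rtt) / R ^ 2 ∧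
    a01 * a⁻¹ + 2 * a0 * r⁻¹ * a⁻¹ = 2 * (Rr * Rt + R * Rtr) / R ^ 2 ∧
    a11 * a⁻¹ + 4 * a1 * r⁻¹ * a⁻¹ + 2 * r⁻¹ ^ 2 = 2 * (Rr ^ 2 + R * Rrr) / R ^ 2 ∧
    a⁻¹ * r⁻¹ ^ 2 = 1 / R ^ 2 := by
  -- The hypotheses are the successive derivatives of R² = r²a; each is solved for the newest
  -- derivative of `a` and substituted.
  obtain rfl : a = R ^ 2 / r ^ 2 := by field_simp; linear_combination -s0
  obtain rfl : a0 = 2 * R * Rt / r ^ 2 := by field_simp; linear_combination -s1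
  obtain rfl : a1 = 2 * R * Rr / r ^ 2 - 2 * R ^ 2 / r ^ 3 := by
    field_simp at s2 ⊢; linear_combination -s2
  obtain rfl : a00 = 2 * (Rt * Rt + R * Rtt) / r ^ 2 := by field_simp; linear_combination -s3
  obtain rfl : a01 = 2 * (Rr * Rt + R * Rtr) / r ^ 2 - 4 * R * Rt / r ^ 3 := by
    field_simp at s4 ⊢; linear_combination -s4
  obtain rfl : a11 = 2 * (Rr * Rr + R * Rrr) / r ^ 2 - 8 * R * Rr / r ^ 3
      + 6 * R ^ 2 / r ^ 4 := by
    field_simp at s5 ⊢; linear_combination -s5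
  refine ⟨?_, ?_, ?_, ?_, ?_, ?_⟩ <;> field_simp <;> ring

namespace IsSphericallySymmetricSpacetime

variable {Ω : Set Coord} {g : MetricField} (hg : IsSphericallySymmetricSpacetime Ω g)
include hg

theorem smooth_axis (i j : Fin 4) :
    ContDiffOn ℝ ∞ (fun z => g (axisPt z) i j) (orbitSpace Ω) :=
  (hg.smooth i j).comp contDiff_axisPt.contDiffOn fun _ hz => hz.1

theorem smooth_orbitRadius : ContDiffOn ℝ ∞ (orbitRadius g) (orbitSpace Ω) :=
  contDiff_snd.contDiffOn.mul
    ((hg.smooth_axis 2 2).sqrt fun _ hz => (hg.signature_axis hz.1).2.ne')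

theorem orbitRadius_pos {z : ℝ × ℝ} (hz : z ∈ orbitSpace Ω) : 0 < orbitRadius g z :=
  mul_pos hz.2 (Real.sqrt_pos.2 (hg.signature_axis hz.1).2)

theorem orbitRadius_sq {z : ℝ × ℝ} (hz : z ∈ orbitSpace Ω) :
    orbitRadius g z * orbitRadius g z = z.2 * (z.2 * g (axisPt z) 2 2) := by
  have := Real.mul_self_sqrt (hg.signature_axis hz.1).2.le
  simp only [orbitRadius]
  linear_combination z.2 ^ 2 * this

theorem dirDeriv_orbitRadius {z : ℝ × ℝ} (hz : z ∈ orbitSpace Ω) (v : ℝ × ℝ) :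
    2 * (orbitRadius g z * dirDeriv v (orbitRadius g) z) =
      2 * v.2 * (z.2 * g (axisPt z) 2 2)
        + z.2 * (z.2 * dirDeriv v (fun z => g (axisPt z) 2 2) z) := by
  have dR := hg.smooth_orbitRadius.differentiableAt_of_mem hg.isOpen_orbitSpace hz
  have da := (hg.smooth_axis 2 2).differentiableAt_of_mem hg.isOpen_orbitSpace hz
  have d2 : DifferentiableAt ℝ (fun y : ℝ × ℝ => y.2) z := differentiableAt_snd
  have e := dirDeriv_congr (v := v) hg.isOpen_orbitSpace hz fun y hy => hg.orbitRadius_sq hy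
  rw [dirDeriv_mul dR dR, dirDeriv_mul d2 (d2.fun_mul da), dirDeriv_mul d2 da, dirDeriv_snd] at e
  linear_combination e

theorem dirDeriv_dirDeriv_orbitRadius {z : ℝ × ℝ} (hz : z ∈ orbitSpace Ω) (v w : ℝ × ℝ) :
    2 * (dirDeriv w (orbitRadius g) z * dirDeriv v (orbitRadius g) z
        + orbitRadius g z * dirDeriv w (dirDeriv v (orbitRadius g)) z) =
      2 * v.2 * w.2 * g (axisPt z) 2 2
        + 2 * v.2 * z.2 * dirDeriv w (fun z => g (axisPt z) 2 2) z
        + 2 * w.2 * z.2 * dirDeriv v (fun z => g (axisPt z) 2 2) z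
        + z.2 ^ 2 * dirDeriv w (dirDeriv v (fun z => g (axisPt z) 2 2)) z := by
  have hO := hg.isOpen_orbitSpace
  have dR := hg.smooth_orbitRadius.differentiableAt_of_mem hO hz
  have da := (hg.smooth_axis 2 2).differentiableAt_of_mem hO hz
  have dRv := (hg.smooth_orbitRadius.dirDeriv hO v).differentiableAt_of_mem hO hz
  have dav := ((hg.smooth_axis 2 2).dirDeriv hO v).differentiableAt_of_mem hO hz
  have d2 : DifferentiableAt ℝ (fun y : ℝ × ℝ => y.2) z := differentiableAt_snd
  have dc : ∀ c : ℝ, DifferentiableAt ℝ (fun _ : ℝ × ℝ => c) z := differentiableAt_const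
  have e := dirDeriv_congr (v := w) hO hz fun y hy => hg.dirDeriv_orbitRadius hy v
  rw [dirDeriv_mul (dc _) (dR.fun_mul dRv), dirDeriv_mul dR dRv,
    dirDeriv_add ((dc _).fun_mul (d2.fun_mul da)) (d2.fun_mul (d2.fun_mul dav)),
    dirDeriv_mul (dc _) (d2.fun_mul da), dirDeriv_mul d2 da, dirDeriv_mul d2 (d2.fun_mul dav),
    dirDeriv_mul d2 dav, dirDeriv_snd, dirDeriv_const, dirDeriv_const] at e
  linear_combination e

theorem dt_axis {z : ℝ × ℝ} (hz : axisPt z ∈ Ω) (i j : Fin 4) :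
    dt (fun z => g (axisPt z) i j) z = pdMat 0 g (axisPt z) i j :=
  (dirDeriv_comp_axisPt (u := fun x => g x i j) (hg.differentiableAt hz i j)).1

theorem dr_axis {z : ℝ × ℝ} (hz : axisPt z ∈ Ω) (i j : Fin 4) :
    dr (fun z => g (axisPt z) i j) z = pdMat 1 g (axisPt z) i j :=
  (dirDeriv_comp_axisPt (u := fun x => g x i j) (hg.differentiableAt hz i j)).2

theorem second_deriv_axis {z : ℝ × ℝ} (hz : z ∈ orbitSpace Ω) (i j : Fin 4) :
    dt (dt (fun z => g (axisPt z) i j)) z = pdMat 0 (pdMat 0 g) (axisPt z) i j ∧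
    dr (dt (fun z => g (axisPt z) i j)) z = pdMat 0 (pdMat 1 g) (axisPt z) i j ∧
    dr (dr (fun z => g (axisPt z) i j)) z = pdMat 1 (pdMat 1 g) (axisPt z) i j := by
  have hO := hg.isOpen_orbitSpace
  have h0 := dirDeriv_comp_axisPt (u := fun x => pdMat 0 g x i j)
    (hg.differentiableAt_pdMat hz.1 0 i j)
  have h1 := dirDeriv_comp_axisPt (u := fun x => pdMat 1 g x i j)
    (hg.differentiableAt_pdMat hz.1 1 i j)
  refine ⟨?_, ?_, ?_⟩
  · exact (dirDeriv_congr hO hz fun y hy => hg.dt_axis hy.1 i j).trans h0.1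
  · rw [← hg.pdMat_comm hz.1 1 0]
    exact (dirDeriv_congr hO hz fun y hy => hg.dt_axis hy.1 i j).trans h0.2
  · exact (dirDeriv_congr hO hz fun y hy => hg.dr_axis hy.1 i j).trans h1.2

/-- The Einstein equations reduced to the orbit space. -/
theorem isReducedEinstein {Λ : ℝ} (hE : IsEinstein Ω g Λ) :
    IsReducedEinstein (fun z => g (axisPt z) 0 0) (fun z => g (axisPt z) 0 1)
      (fun z => g (axisPt z) 1 1) (orbitRadius g) Λ (orbitSpace Ω) := by
  -- All functions and derivatives at `z` are replaced by real variables, so that what remains is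
  -- pure algebra.
  have key : ∀ z ∈ orbitSpace Ω, ∀ A B C A0 B0 C0 A1 B1 C1 R Rt Rr Rtt Rtr Rrr u w N : ℝ,
      g (axisPt z) 0 0 = A → g (axisPt z) 0 1 = B → g (axisPt z) 1 1 = C →
      dt (fun z => g (axisPt z) 0 0) z = A0 → dt (fun z => g (axisPt z) 0 1) z = B0 →
      dt (fun z => g (axisPt z) 1 1) z = C0 →
      dr (fun z => g (axisPt z) 0 0) z = A1 → dr (fun z => g (axisPt z) 0 1) z = B1 →
      dr (fun z => g (axisPt z) 1 1) z = C1 →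
      orbitRadius g z = R → dt (orbitRadius g) z = Rt → dr (orbitRadius g) z = Rr →
      dt (dt (orbitRadius g)) z = Rtt → dr (dt (orbitRadius g)) z = Rtr →
      dr (dr (orbitRadius g)) z = Rrr →
      u = (-C * Rt + B * Rr) / (B ^ 2 - A * C) → w = (B * Rt - A * Rr) / (B ^ 2 - A * C) →
      N = u * Rt + w * Rr →
      2 * R * (Rtt - (A0 / 2 * u + (B0 - A1 / 2) * w)) = (1 - N - Λ * R ^ 2) * A ∧
      2 * R * (Rtr - (A1 / 2 * u + C0 / 2 * w)) = (1 - N - Λ * R ^ 2) * B ∧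
      2 * R * (Rrr - ((B1 - C0 / 2) * u + C1 / 2 * w)) = (1 - N - Λ * R ^ 2) * C := by
    intro z hz A B C A0 B0 C0 A1 B1 C1 R Rt Rr Rtt Rtr Rrr u w N hA hB hC hA0 hB0 hC0 hA1 hB1 hC1
      hR hRt hRr hRtt hRtr hRrr hu hw hN
    obtain ⟨hdet, ha⟩ := hg.signature_axis hz.1
    have hax := hg.metric_axis hz.1
    have data := hg.axialData hz.1
    dsimp only at data
    have E := hE _ hz.1
    have hinv := inv_axialMat (C := g (axisPt z) 1 1) (sub_pos.2 hdet).ne' ha.ne'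
    rw [← hax] at hinv
    have ric := ricci_eq_ricciExpr hg.isOpen hg.smooth (fun x hx => hg.det_ne_zero hx) hz.1
    rw [hinv] at ric
    have E0 := (ric 0 0).symm.trans (E 0 0)
    have E1 := (ric 0 1).symm.trans (E 0 1)
    have E2 := (ric 1 1).symm.trans (E 1 1)
    have E3 := (ric 2 2).symm.trans (E 2 2)
    have hr := hz.2
    have hRpos := hg.orbitRadius_pos hz
    have s0 := hg.orbitRadius_sq hz
    have s1 := hg.dirDeriv_orbitRadius hz (1, 0)
    have s2 := hg.dirDeriv_orbitRadius hz (0, 1)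
    have s3 := hg.dirDeriv_dirDeriv_orbitRadius hz (1, 0) (1, 0)
    have s4 := hg.dirDeriv_dirDeriv_orbitRadius hz (1, 0) (0, 1)
    have s5 := hg.dirDeriv_dirDeriv_orbitRadius hz (0, 1) (0, 1)
    obtain ⟨a00, a01, a11⟩ := hg.second_deriv_axis hz 2 2
    have at0 := hg.dt_axis hz.1 2 2
    have ar0 := hg.dr_axis hz.1 2 2
    rw [hg.dt_axis hz.1] at hA0 hB0 hC0
    rw [hg.dr_axis hz.1] at hA1 hB1 hC1
    rw [hA, hB, hC, hA0, hB0, hC0, hA1, hB1, hC1] at data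
    rw [hA, hB, hC] at E0 E1 E2 E3 hdet
    simp only [dt, dr] at hRt hRr hRtt hRtr hRrr at0 ar0 a00 a01 a11
    rw [hR, hRt, at0] at s1
    rw [hR, hRr, ar0] at s2
    rw [hR, hRt, hRtt, at0, a00] at s3
    rw [hR, hRt, hRr, hRtr, at0, ar0, a01] at s4
    rw [hR, hRr, hRrr, ar0, a11] at s5
    rw [hR] at s0 hRpos
    clear hR hRt hRr hRtt hRtr hRrr at0 ar0 a00 a01 a11 hA0 hB0 hC0 hA1 hB1 hC1 hA hB hC hinv ric E
      hax
    have hδ : 0 < B ^ 2 - A * C := sub_pos.2 hdet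
    generalize g (axisPt z) 2 2 = a at *
    generalize z.2 = r at *
    generalize pdMat 0 g (axisPt z) 2 2 = a0 at *
    generalize pdMat 1 g (axisPt z) 2 2 = a1 at *
    generalize pdMat 0 (pdMat 0 g) (axisPt z) 2 2 = a00 at *
    generalize pdMat 0 (pdMat 1 g) (axisPt z) 2 2 = a01 at *
    generalize pdMat 1 (pdMat 1 g) (axisPt z) 2 2 = a11 at *
    obtain ⟨δ, hδe⟩ : ∃ δ, δ = B ^ 2 - A * C := ⟨_, rfl⟩
    rw [← hδe] at E0 E1 E2 E3 hδ hu hw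
    obtain ⟨p, hp⟩ : ∃ p, p = -C / δ := ⟨_, rfl⟩
    obtain ⟨q, hq⟩ : ∃ q, q = B / δ := ⟨_, rfl⟩
    obtain ⟨s, hs⟩ : ∃ s, s = -A / δ := ⟨_, rfl⟩
    rw [← hp, ← hq, ← hs] at E0 E1 E2 E3
    have hqB : q * B + s * C = 1 := by
      rw [hq, hs]; field_simp; rw [hδe]; ring
    have hpB : p * B + q * C = 0 := by rw [hq, hp]; ring
    have he : a⁻¹ * a = 1 := inv_mul_cancel₀ ha.ne'
    rw [data.ricciExpr_zero_zero p q s _ hqB hpB he] at E0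
    rw [data.ricciExpr_zero_one p q s _ hqB hpB he] at E1
    rw [data.ricciExpr_one_one p q s _ hqB hpB he] at E2
    rw [data.ricciExpr_two_two p q s _ hqB hpB he] at E3
    have hu' : u = p * Rt + q * Rr := by rw [hu, hp, hq]; ring
    have hw' : w = q * Rt + s * Rr := by rw [hw, hs, hq]; ring
    obtain ⟨r0, r1, r00, r01, r11, hrr⟩ :=
      areal_identities hr hRpos s0 (by simpa using s1) (by simpa using s2) (by simpa using s3)
        (by simpa using s4) (by simpa using s5)
    obtain ⟨h0, h1, h2⟩ := hess_eq_of_einstein hδe hδ.ne' ha.ne' hp hq hs E0 E1 E2 E3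
    simp only [hess00, hess01, hess11, r0, r1, r00, r01, r11, hrr] at h0 h1 h2
    subst hN hu' hw'
    refine ⟨?_, ?_, ?_⟩
    -- `h0` reads 2∇∇R/R = (1/R² - N/R² - Λ) h in the tt-component; the factor R² turns it into the
    -- reduced equation.
    · linear_combination (norm := (field_simp; ring)) R ^ 2 * h0
    · linear_combination (norm := (field_simp; ring)) R ^ 2 * h1
    · linear_combination (norm := (field_simp; ring)) R ^ 2 * h2
  refine ⟨hg.isOpen_orbitSpace, hg.isPreconnected_orbitSpace, hg.smooth_axis _ _,
    hg.smooth_axis _ _, hg.smooth_axis _ _, hg.smooth_orbitRadius,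
    fun z hz => sub_pos.2 (hg.signature_axis hz.1).1, fun z hz => hg.orbitRadius_pos hz,
    fun z hz => ?_, fun z hz => ?_, fun z hz => ?_⟩
  · exact (key z hz _ _ _ _ _ _ _ _ _ _ _ _ _ _ _ _ _ _ rfl rfl rfl rfl rfl rfl rfl rfl rfl rfl
      rfl rfl rfl rfl rfl rfl rfl rfl).1
  · exact (key z hz _ _ _ _ _ _ _ _ _ _ _ _ _ _ _ _ _ _ rfl rfl rfl rfl rfl rfl rfl rfl rfl rfl
      rfl rfl rfl rfl rfl rfl rfl rfl).2.1
  · exact (key z hz _ _ _ _ _ _ _ _ _ _ _ _ _ _ _ _ _ _ rfl rfl rfl rfl rfl rfl rfl rfl rfl rfl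
      rfl rfl rfl rfl rfl rfl rfl rfl).2.2

end IsSphericallySymmetricSpacetime

/-! ### Schwarzschild–(A)de Sitter charts -/

/-- The squared norm of the gradient of the areal radius on the orbit space. -/
def orbitGradSq (g : MetricField) : ℝ × ℝ → ℝ :=
  gradNormSq (fun z => g (axisPt z) 0 0) (fun z => g (axisPt z) 0 1) (fun z => g (axisPt z) 1 1)
    (orbitRadius g)

/-- The volume density of the orbit space. -/
def orbitVol (g : MetricField) (z : ℝ × ℝ) : ℝ :=
  √(negDet (fun z => g (axisPt z) 0 0) (fun z => g (axisPt z) 0 1) (fun z => g (axisPt z) 1 1) z)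

/-- The first component of the form `dT` on the orbit space. -/
def timeForm0 (g : MetricField) (z : ℝ × ℝ) : ℝ :=
  orbitVol g z * gradR (fun z => g (axisPt z) 0 0) (fun z => g (axisPt z) 0 1)
    (fun z => g (axisPt z) 1 1) (orbitRadius g) z / orbitGradSq g z

/-- The second component of the form `dT` on the orbit space. -/
def timeForm1 (g : MetricField) (z : ℝ × ℝ) : ℝ :=
  -(orbitVol g z * gradT (fun z => g (axisPt z) 0 0) (fun z => g (axisPt z) 0 1)
    (fun z => g (axisPt z) 1 1) (orbitRadius g) z / orbitGradSq g z)

/-- The inverse function theorem in the plane: the Jacobian condition makes the derivative of (T, R)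
injective, hence an isomorphism. -/
theorem exists_injOn_of_jacobian {T R : ℝ × ℝ → ℝ} {B : Set (ℝ × ℝ)} (hB : IsOpen B) {z : ℝ × ℝ}
    (hz : z ∈ B) (hT : ContDiffOn ℝ ∞ T B) (hR : ContDiffOn ℝ ∞ R B)
    (hJ : dt T z * dr R z - dr T z * dt R z ≠ 0) :
    ∃ U, IsOpen U ∧ U ⊆ B ∧ z ∈ U ∧ Set.InjOn (fun w => (T w, R w)) U := by
  have hs : HasStrictFDerivAt (fun w => (T w, R w)) ((fderiv ℝ T z).prod (fderiv ℝ R z)) z :=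
    ((hT.contDiffAt (hB.mem_nhds hz)).hasStrictFDerivAt (by simp)).prodMk
      ((hR.contDiffAt (hB.mem_nhds hz)).hasStrictFDerivAt (by simp))
  have e : ∀ (u : ℝ × ℝ → ℝ) (w : ℝ × ℝ), fderiv ℝ u z w = w.1 * dt u z + w.2 * dr u z := by
    intro u w
    have hw : w = w.1 • ((1, 0) : ℝ × ℝ) + w.2 • ((0, 1) : ℝ × ℝ) := by ext <;> simp
    conv_lhs => rw [hw, map_add, map_smul, map_smul]
    rfl
  let L : ℝ × ℝ →ₗ[ℝ] ℝ × ℝ := ((fderiv ℝ T z).prod (fderiv ℝ R z) : ℝ × ℝ →L[ℝ] ℝ × ℝ)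
  have hinj : Function.Injective L := by
    rw [← LinearMap.ker_eq_bot, LinearMap.ker_eq_bot']
    intro w hw
    have h1 : fderiv ℝ T z w = 0 := congrArg Prod.fst hw
    have h2 : fderiv ℝ R z w = 0 := congrArg Prod.snd hw
    rw [e] at h1 h2
    have h3 : w.1 * (dt T z * dr R z - dr T z * dt R z) = 0 := by
      linear_combination dr R z * h1 - dr T z * h2
    have h4 : w.2 * (dt T z * dr R z - dr T z * dt R z) = 0 := by
      linear_combination dt T z * h2 - dt R z * h1
    exact Prod.ext ((mul_eq_zero.1 h3).resolve_right hJ) ((mul_eq_zero.1 h4).resolve_right hJ)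
  let E : (ℝ × ℝ) ≃L[ℝ] ℝ × ℝ := (LinearEquiv.ofInjectiveEndo L hinj).toContinuousLinearEquiv
  have hE : (E : ℝ × ℝ →L[ℝ] ℝ × ℝ) = (fderiv ℝ T z).prod (fderiv ℝ R z) := by
    ext <;> rfl
  rw [← hE] at hs
  refine ⟨(hs.toOpenPartialHomeomorph _).source ∩ B,
    (hs.toOpenPartialHomeomorph _).open_source.inter hB, Set.inter_subset_right,
    ⟨hs.mem_toOpenPartialHomeomorph_source, hz⟩, ?_⟩
  exact (hs.toOpenPartialHomeomorph _).injOn.mono Set.inter_subset_left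

theorem orbitMap_injective {x y : Coord} (hx : 0 < radius x) (h : orbitMap x = orbitMap y)
    (hdir : ∀ k : Fin 3, x k.succ / radius x = y k.succ / radius y) : x = y := by
  have h0 : x 0 = y 0 := congrArg Prod.fst h
  have hr : radius x = radius y := congrArg Prod.snd h
  ext i
  refine Fin.cases h0 (fun k => ?_) i
  have := hdir k
  rw [← hr] at this
  exact (div_left_inj' hx.ne').1 this

namespace IsSphericallySymmetricSpacetime

variable {Ω : Set Coord} {g : MetricField} (hg : IsSphericallySymmetricSpacetime Ω g)
include hg

/-- The rotation fields are tangent to the spheres, where g is `a` times the Euclidean metric; the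
squared length of ξ_k is a(|x|² - x_k²), and the sum over k is 2a|x|². -/
theorem arealRadius_eq {x : Coord} (hx : x ∈ Ω) : arealRadius g x = orbitRadius g (orbitMap x) := by
  have hr := hg.radius_pos x hx
  have hm := hg.metric_apply hx
  have hsq : (1 / 2) * ∑ k, rotField k x ⬝ᵥ (g x *ᵥ rotField k x) =
      radius x ^ 2 * g (axisPt (orbitMap x)) 2 2 := by
    rw [radius_sq]
    have h : ∀ k : Fin 3, rotField k x ⬝ᵥ (g x *ᵥ rotField k x) =
        g (axisPt (orbitMap x)) 2 2 * (x 1 ^ 2 + x 2 ^ 2 + x 3 ^ 2 - x k.succ ^ 2) := by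
      intro k
      simp only [dotProduct, Matrix.mulVec, Fin.sum_univ_four, hm]
      fin_cases k <;> simp [rotField, timeCovec, radialCovec, roundMetric] <;> field_simp <;> ring
    rw [Fin.sum_univ_three, h, h, h]
    change 1 / 2 * (_ * (_ - x 1 ^ 2) + _ * (_ - x 2 ^ 2) + _ * (_ - x 3 ^ 2)) = _
    ring
  rw [arealRadius, hsq, Real.sqrt_mul (by positivity), Real.sqrt_sq hr.le]
  rfl

theorem pd_arealRadius {x : Coord} (hx : x ∈ Ω) {R : Coord → ℝ}
    (hR : ∀ x ∈ Ω, R x = orbitRadius g (orbitMap x)) (i : Fin 4) :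
    pd i R x = dt (orbitRadius g) (orbitMap x) * timeCovec i
      + dr (orbitRadius g) (orbitMap x) * radialCovec x i := by
  rw [← pd_comp_orbitMap (hg.radius_pos x hx)
    (hg.smooth_orbitRadius.differentiableAt_of_mem hg.isOpen_orbitSpace (hg.orbitMap_mem hx))]
  exact pd_congr (by filter_upwards [hg.isOpen.mem_nhds hx] with y hy using hR y hy)

theorem gradSq_arealRadius {Λ : ℝ} (hE : IsEinstein Ω g Λ) {x : Coord} (hx : x ∈ Ω) :
    gradSq g (arealRadius g) x = orbitGradSq g (orbitMap x) := by
  have red := hg.isReducedEinstein hE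
  have hz := hg.orbitMap_mem hx
  have hr := hg.radius_pos x hx
  have hrs := radius_sq x
  set u := gradT (fun z => g (axisPt z) 0 0) (fun z => g (axisPt z) 0 1)
    (fun z => g (axisPt z) 1 1) (orbitRadius g) (orbitMap x) with hu
  set w := gradR (fun z => g (axisPt z) 0 0) (fun z => g (axisPt z) 0 1)
    (fun z => g (axisPt z) 1 1) (orbitRadius g) (orbitMap x) with hw
  have l0 := red.lower_t hz
  have l1 := red.lower_r hz
  have hgrad : orbitGradSq g (orbitMap x) =
    u * dt (orbitRadius g) (orbitMap x) + w * dr (orbitRadius g) (orbitMap x) := rfl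
  rw [← hu, ← hw] at l0 l1
  clear_value u w
  have hpd := fun i => hg.pd_arealRadius hx (fun _ h => hg.arealRadius_eq h) i
  -- The lift of the orbit-space gradient. Checking g V = dR identifies it as the gradient of R
  -- without computing the inverse of `g x`.
  let V : Fin 4 → ℝ := fun i => u * timeCovec i + w * radialCovec x i
  let η : Fin 4 → ℝ := fun i => pd i (arealRadius g) x
  have hn : (x 1 / radius x) ^ 2 + (x 2 / radius x) ^ 2 + (x 3 / radius x) ^ 2 = 1 := by
    field_simp; linarith
  have hround : ∀ i j : Fin 4, radius x ^ 2 * g (axisPt (orbitMap x)) 2 2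
      * roundMetric x i j = g (axisPt (orbitMap x)) 2 2
        * (if i = 0 ∨ j = 0 then 0
          else ((if i = j then 1 else 0) - (x i / radius x) * (x j / radius x))) := by
    intro i j
    simp only [roundMetric]
    split_ifs
    · rw [mul_zero, mul_zero]
    all_goals field_simp
  have hV : g x *ᵥ V = η := by
    ext i
    simp only [Matrix.mulVec, dotProduct, Fin.sum_univ_four, hg.metric_apply hx, V, η, hpd,
      hround, ← l0, ← l1]
    generalize g (axisPt (orbitMap x)) = G at *
    obtain ⟨n, hn'⟩ : ∃ n : Fin 4 → ℝ, ∀ i, x i / radius x = n i := ⟨_, fun _ => rfl⟩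
    simp only [timeCovec, radialCovec, hn'] at hn ⊢
    clear hround hpd l0 l1 hgrad hu hw
    fin_cases i <;> simp
    · linear_combination G 0 1 * w * hn
    · linear_combination (G 1 1 - G 2 2) * w * n 1 * hn
    · linear_combination (G 1 1 - G 2 2) * w * n 2 * hn
    · linear_combination (G 1 1 - G 2 2) * w * n 3 * hn
  have hGη : (g x)⁻¹ *ᵥ η = V := by
    rw [← hV, Matrix.mulVec_mulVec, Matrix.nonsing_inv_mul _ (hg.det_ne_zero hx).isUnit,
      Matrix.one_mulVec]
  have hgs : gradSq g (arealRadius g) x = ∑ i, η i * V i := by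
    rw [← hGη]
    simp only [gradSq, Matrix.mulVec, dotProduct, η, Finset.mul_sum]
    exact Finset.sum_congr rfl fun i _ => Finset.sum_congr rfl fun j _ => by ring
  rw [hgs, hgrad]
  simp only [η, V, hpd, Fin.sum_univ_four, timeCovec, radialCovec]
  simp
  linear_combination w * dr (orbitRadius g) (orbitMap x) * hn

/-- Pulls a chart of the orbit space back along `orbitMap`. The function `R` is only required to
agree with the areal radius on `Ω`, so that it can be `arealRadius g` in the local statement and
`radius` in the global one. -/
theorem isSdSChart {Λ M : ℝ} (hE : IsEinstein Ω g Λ)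
    (hM : ∀ z ∈ orbitSpace Ω, orbitGradSq g z = sdsF M (Λ / 6) (orbitRadius g z))
    {U : Set (ℝ × ℝ)} (hU : IsOpen U) (hUO : U ⊆ orbitSpace Ω)
    (hN : ∀ z ∈ U, orbitGradSq g z ≠ 0) {T : ℝ × ℝ → ℝ} (sT : ContDiffOn ℝ ∞ T U)
    (hT : ∀ z ∈ U, dt T z = timeForm0 g z ∧ dr T z = timeForm1 g z)
    (hinj : Set.InjOn (fun z => (T z, orbitRadius g z)) U) {R : Coord → ℝ}
    (hR : ∀ x ∈ Ω, R x = orbitRadius g (orbitMap x)) :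
    IsSdSChart M (Λ / 6) g (Ω ∩ orbitMap ⁻¹' U) (fun x => T (orbitMap x)) R where
  isOpen := hg.isOpen.inter (hU.preimage continuous_orbitMap)
  rot_mem := fun A hA x hx => ⟨hg.rot_mem A hA x hx.1, by
    rw [Set.mem_preimage, orbitMap_rot hA]; exact hx.2⟩
  smooth_time := sT.comp (contDiffOn_orbitMap fun x hx => hg.radius_pos x hx.1) fun _ hx => hx.2
  smooth_radius := (hg.smooth_orbitRadius.comp
    (contDiffOn_orbitMap fun x (hx : x ∈ Ω ∩ orbitMap ⁻¹' U) => hg.radius_pos x hx.1)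
    fun _ hx => hUO hx.2).congr fun x hx => hR x hx.1
  rot_time := fun A hA x _ => congrArg T (orbitMap_rot hA x)
  rot_radius := fun A hA x hx => by
    rw [hR x hx.1, hR _ (hg.rot_mem A hA x hx.1), orbitMap_rot hA]
  injOn := by
    intro x hx y hy hxy
    simp only [Prod.mk.injEq] at hxy
    obtain ⟨h1, h2, h3⟩ := hxy
    rw [hR x hx.1, hR y hy.1] at h2
    exact orbitMap_injective (hg.radius_pos x hx.1)
      (hinj hx.2 hy.2 (Prod.ext h1 h2)) fun k => congrFun h3 k
  radius_pos := fun x hx => by rw [hR x hx.1]; exact hg.orbitRadius_pos (hUO hx.2)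
  sdsF_ne_zero := fun x hx => by rw [hR x hx.1, ← hM _ (hUO hx.2)]; exact hN _ hx.2
  metric_eq := by
    intro x hx i j
    have hz := hUO hx.2
    have hr := hg.radius_pos x hx.1
    obtain ⟨m0, m1, m2, -⟩ := (hg.isReducedEinstein hE).metric_eq hz (hN _ hx.2)
    have hsq := hg.orbitRadius_sq hz
    have pT := pd_comp_orbitMap hr (sT.differentiableAt_of_mem hU hx.2)
    have pR := hg.pd_arealRadius hx.1 hR
    obtain ⟨t0, t1⟩ := hT _ hx.2
    change g (axisPt (orbitMap x)) 0 0 = -orbitGradSq g (orbitMap x) * timeForm0 g (orbitMap x)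
      * timeForm0 g (orbitMap x) + (orbitGradSq g (orbitMap x))⁻¹ * _ * _ at m0
    change g (axisPt (orbitMap x)) 0 1 = -orbitGradSq g (orbitMap x) * timeForm0 g (orbitMap x)
      * timeForm1 g (orbitMap x) + (orbitGradSq g (orbitMap x))⁻¹ * _ * _ at m1
    change g (axisPt (orbitMap x)) 1 1 = -orbitGradSq g (orbitMap x) * timeForm1 g (orbitMap x)
      * timeForm1 g (orbitMap x) + (orbitGradSq g (orbitMap x))⁻¹ * _ * _ at m2
    change _ = radius x * (radius x * _) at hsq
    rw [hg.metric_apply hx.1, hR x hx.1, ← hM _ hz, pT, pT, pR, pR, t0, t1, m0, m1, m2, pow_two,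
      pow_two, hsq]
    ring

end IsSphericallySymmetricSpacetime

namespace IsSphericallySymmetricSpacetime

variable {Ω : Set Coord} {g : MetricField} (hg : IsSphericallySymmetricSpacetime Ω g)
include hg

/-- Schwarzschild–(A)de Sitter coordinates near a point where the areal radius has a non-null
gradient. -/
theorem exists_isSdSChart {Λ M : ℝ} (hE : IsEinstein Ω g Λ)
    (hM : ∀ z ∈ orbitSpace Ω, orbitGradSq g z = sdsF M (Λ / 6) (orbitRadius g z))
    {p : Coord} (hp : p ∈ Ω) (hN : gradSq g (arealRadius g) p ≠ 0) :
    ∃ (V : Set Coord) (T : Coord → ℝ), p ∈ V ∧ V ⊆ Ω ∧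
      IsSdSChart M (Λ / 6) g V T (arealRadius g) := by
  have red := hg.isReducedEinstein hE
  have hz := hg.orbitMap_mem hp
  rw [hg.gradSq_arealRadius hE hp] at hN
  have hO : IsOpen (orbitSpace Ω ∩ orbitGradSq g ⁻¹' {0}ᶜ) :=
    red.smooth_gradNormSq.continuousOn.isOpen_inter_preimage red.isOpen isOpen_compl_singleton
  -- A ball is convex, so the closed time form has a primitive on it.
  obtain ⟨ε, hε, hball⟩ := Metric.isOpen_iff.1 hO (orbitMap p) ⟨hz, hN⟩
  obtain ⟨c0, c1, hcl⟩ := red.timeForm_closed (U := Metric.ball (orbitMap p) ε) Metric.isOpen_ball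
    (fun z h => (hball h).1) (fun z h => (hball h).2)
  obtain ⟨T, sT, hT⟩ := exists_primitive Metric.isOpen_ball (convex_ball _ _) c0 c1 hcl
  have hmem := Metric.mem_ball_self (x := orbitMap p) hε
  obtain ⟨U, hU, hUB, hpU, hinj⟩ := exists_injOn_of_jacobian (R := orbitRadius g)
    Metric.isOpen_ball hmem sT (hg.smooth_orbitRadius.mono fun z h => (hball h).1) (by
      -- The Jacobian of (T, R) is the volume density, which is positive.
      rw [(hT _ hmem).1, (hT _ hmem).2]
      have := (red.metric_eq hz hN).2.2.2
      rw [this]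
      exact (Real.sqrt_pos.2 (red.negDet_pos _ hz)).ne')
  exact ⟨Ω ∩ orbitMap ⁻¹' U, fun x => T (orbitMap x), ⟨hp, hpU⟩, Set.inter_subset_left,
    hg.isSdSChart hE hM hU (fun z h => (hball (hUB h)).1) (fun z h => (hball (hUB h)).2)
      (sT.mono hUB) (fun z h => hT z (hUB h)) hinj fun x hx => hg.arealRadius_eq hx⟩

/-! ### The global time coordinate for a metric in standard form -/

/-- The global form of the metric in Schwarzschild coordinates. -/
theorem exists_time_of_hasStandardForm {Λ M : ℝ} (hE : IsEinstein Ω g Λ)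
    (hM : ∀ z ∈ orbitSpace Ω, orbitGradSq g z = sdsF M (Λ / 6) (orbitRadius g z))
    {I J : Set ℝ} {v f : ℝ → ℝ → ℝ} (h : HasStandardForm Ω g I J v f) :
    ∃ τ : ℝ → ℝ, ContDiffOn ℝ ∞ τ I ∧ (∀ t ∈ I, 0 < deriv τ t) ∧
      (∀ r ∈ J, 0 < sdsF M (Λ / 6) r) ∧
      IsSdSChart M (Λ / 6) g Ω (fun x => τ (x 0)) radius := by
  have red := hg.isReducedEinstein hE
  have hO : orbitSpace Ω = I ×ˢ J := by
    ext z
    have hr : 0 < z.2 → radius (axisPt z) = z.2 := radius_axisPt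
    simp only [orbitSpace, h.domain_eq, Set.mem_ofPred_eq, Set.mem_prod]
    constructor
    · rintro ⟨⟨h1, h2⟩, h3⟩
      exact ⟨h1, hr h3 ▸ h2⟩
    · rintro ⟨h1, h2⟩
      have h3 : 0 < z.2 := h.radius_pos h2
      exact ⟨⟨h1, (hr h3).symm ▸ h2⟩, h3⟩
  have hax : ∀ z ∈ orbitSpace Ω, g (axisPt z) 0 1 = 0 ∧ 0 < g (axisPt z) 1 1 ∧
      g (axisPt z) 2 2 = 1 := by
    intro z hz
    have hz2 := hz.2.ne'
    have m := h.metric_eq _ hz.1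
    have hr := radius_axisPt hz.2
    simp only [pd_coord, pd_radius (hg.radius_pos _ hz.1)] at m
    refine ⟨?_, ?_, ?_⟩
    · rw [m]; simp [radialCovec, roundMetric]
    · rw [m]
      simp only [radialCovec, roundMetric, hr]
      simp [axisPt, hz2, Real.exp_pos, pow_two]
    · rw [m]
      simp only [radialCovec, roundMetric, hr]
      simp [axisPt, hz2]
  have hR : ∀ z ∈ orbitSpace Ω, orbitRadius g z = z.2 := fun z hz => by
    rw [orbitRadius, (hax z hz).2.2, Real.sqrt_one, mul_one]
  have hRt : ∀ z ∈ orbitSpace Ω, dt (orbitRadius g) z = 0 ∧ dr (orbitRadius g) z = 1 := by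
    intro z hz
    have e := fun w => dirDeriv_congr (v := w) red.isOpen hz hR
    exact ⟨(e _).trans dirDeriv_snd, (e _).trans dirDeriv_snd⟩
  -- With B = 0 and R = r the gradient is C⁻¹∂_r, so N = 1/C > 0 and the time form is a positive
  -- multiple of dt.
  have hgrad : ∀ z ∈ orbitSpace Ω, timeForm1 g z = 0 ∧ 0 < timeForm0 g z ∧
      0 < orbitGradSq g z := by
    intro z hz
    have l0 := red.lower_t hz
    have l1 := red.lower_r hz
    have hd := red.negDet_pos z hz
    obtain ⟨hB, hC, -⟩ := hax z hz
    obtain ⟨h0, h1⟩ := hRt z hz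
    rw [h0] at l0
    rw [h1] at l1
    simp only [hB, negDet] at l0 l1 hd
    have hA : g (axisPt z) 0 0 < 0 := by nlinarith
    have hu : gradT (fun z => g (axisPt z) 0 0) (fun z => g (axisPt z) 0 1)
        (fun z => g (axisPt z) 1 1) (orbitRadius g) z = 0 := by
      rw [zero_mul, add_zero] at l0
      exact (mul_eq_zero.1 l0).resolve_left hA.ne
    have hw : 0 < gradR (fun z => g (axisPt z) 0 0) (fun z => g (axisPt z) 0 1)
        (fun z => g (axisPt z) 1 1) (orbitRadius g) z := by
      rw [zero_mul, zero_add] at l1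
      exact pos_of_mul_pos_right (l1 ▸ one_pos) hC.le
    have hN : 0 < orbitGradSq g z := by
      rw [orbitGradSq, gradNormSq, hu, h1]; linarith
    refine ⟨?_, ?_, hN⟩
    · rw [timeForm1, hu]; simp
    · exact div_pos (mul_pos (Real.sqrt_pos.2 (red.negDet_pos z hz)) hw) hN
  obtain ⟨x, hx⟩ := hg.isConnected.nonempty
  have hx' := hg.orbitMap_mem hx
  rw [hO] at hx'
  obtain ⟨ht0, hr0⟩ : x 0 ∈ I ∧ radius x ∈ J := hx'
  have hIJ : ∀ t ∈ I, ∀ r ∈ J, (t, r) ∈ orbitSpace Ω := fun t ht r hr => hO ▸ ⟨ht, hr⟩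
  have hconv : Convex ℝ (orbitSpace Ω) := hO ▸ h.interval_time.convex.prod h.interval_radius.convex
  obtain ⟨c0, c1, hcl⟩ := red.timeForm_closed red.isOpen subset_rfl
    (fun z hz => (hgrad z hz).2.2.ne')
  obtain ⟨T, sT, hT⟩ := exists_primitive red.isOpen hconv c0 c1 hcl
  have dT := fun z hz => sT.differentiableAt_of_mem (z := z) red.isOpen hz
  -- The dr-component of dT vanishes and `J` is an interval, so T does not depend on r; its value at
  -- a fixed radius serves as τ.
  have hconst : ∀ t ∈ I, ∀ r ∈ J, T (t, r) = T (t, radius x) := by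
    intro t ht r hr
    have hd : ∀ s ∈ J, HasDerivAt (fun s => T (t, s)) 0 s := by
      intro s hs
      have hz := hIJ t ht s hs
      have hc := (dT _ hz).hasFDerivAt.comp_hasDerivAt s
        ((hasDerivAt_const s t).prodMk (hasDerivAt_id s))
      have e : fderiv ℝ T (t, s) (0, 1) = 0 := (hT _ hz).2.trans (hgrad _ hz).1
      rw [e] at hc
      exact hc
    exact h.isOpen_radius.is_const_of_deriv_eq_zero h.interval_radius.isPreconnected
      (fun s hs => (hd s hs).differentiableAt.differentiableWithinAt) (fun s hs => (hd s hs).deriv)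
      hr hr0
  have sτ : ContDiffOn ℝ ∞ (fun t => T (t, radius x)) I :=
    sT.comp (contDiff_prodMk_left _).contDiffOn fun t ht => hIJ t ht _ hr0
  have hτ : ∀ t ∈ I, 0 < deriv (fun t => T (t, radius x)) t := by
    intro t ht
    have hz := hIJ t ht _ hr0
    have hc := (dT _ hz).hasFDerivAt.comp_hasDerivAt t
      ((hasDerivAt_id t).prodMk (hasDerivAt_const t (radius x)))
    have e : fderiv ℝ T (t, radius x) (1, 0) = timeForm0 g (t, radius x) := (hT _ hz).1
    rw [e] at hc
    have hc' : HasDerivAt (fun t => T (t, radius x)) (timeForm0 g (t, radius x)) t := hc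
    rw [hc'.deriv]
    exact (hgrad _ hz).2.1
  have hTτ : ∀ z ∈ orbitSpace Ω, T (z.1, radius x) = T z := fun z hz => by
    have hz' := hO ▸ hz
    exact (hconst z.1 hz'.1 z.2 hz'.2).symm
  refine ⟨fun t => T (t, radius x), sτ, hτ, fun r hr => ?_, ?_⟩
  · have hz := hIJ _ ht0 r hr
    have := hM _ hz
    rw [hR _ hz] at this
    exact this ▸ (hgrad _ hz).2.2
  -- τ is strictly increasing on the interval `I`, so (τ, r) is injective on the whole rectangle and
  -- no shrinking is needed.
  · have hmono : StrictMonoOn (fun t => T (t, radius x)) I :=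
      strictMonoOn_of_deriv_pos h.interval_time.convex sτ.continuousOn
        fun t ht => hτ t (interior_subset ht)
    have hchart := hg.isSdSChart hE hM (U := orbitSpace Ω) red.isOpen subset_rfl
      (fun z hz => (hgrad z hz).2.2.ne') (T := fun z => T (z.1, radius x)) (sT.congr hTτ)
      (fun z hz => ⟨(dirDeriv_congr red.isOpen hz hTτ).trans (hT z hz).1,
        (dirDeriv_congr red.isOpen hz hTτ).trans (hT z hz).2⟩)
      (by
        intro z hz w hw hzw
        obtain ⟨h1, h2⟩ := Prod.mk.inj hzw
        rw [hR z hz, hR w hw] at h2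
        exact Prod.ext (hmono.injOn (hO ▸ hz).1 (hO ▸ hw).1 h1) h2)
      (R := radius) (fun y hy => (hR _ (hg.orbitMap_mem hy)).symm)
    have hΩ : Ω ∩ orbitMap ⁻¹' orbitSpace Ω = Ω :=
      Set.inter_eq_left.2 fun y hy => hg.orbitMap_mem hy
    rwa [hΩ] at hchart

end IsSphericallySymmetricSpacetime

end

theorem theorem1 (Ω : Set Coord) (g : MetricField) (Λ : ℝ)
    (hg : IsSphericallySymmetricSpacetime Ω g) (hE : IsEinstein Ω g Λ) :
    ∃ M : ℝ,
      (∀ p ∈ Ω, gradSq g (arealRadius g) p ≠ 0 →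
        ∃ (V : Set Coord) (T : Coord → ℝ), p ∈ V ∧ V ⊆ Ω ∧
          IsSdSChart M (Λ / 6) g V T (arealRadius g)) ∧
      (∀ (I J : Set ℝ) (v f : ℝ → ℝ → ℝ), HasStandardForm Ω g I J v f →
        ∃ τ : ℝ → ℝ, ContDiffOn ℝ ∞ τ I ∧ (∀ t ∈ I, 0 < deriv τ t) ∧
          (∀ r ∈ J, 0 < sdsF M (Λ / 6) r) ∧
          IsSdSChart M (Λ / 6) g Ω (fun x => τ (x 0)) radius) := by
  obtain ⟨M, hM⟩ := (hg.isReducedEinstein hE).exists_mass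
  exact ⟨M, fun p hp hN => hg.exists_isSdSChart hE hM hp hN,
    fun I J v f h => hg.exists_time_of_hasStandardForm hE hM h⟩
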